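/- Work over $\mathbb C$. For a finite-dimensional vector space $V$ of dimension $k\ge 0$, let $S^k\mathbb C=\mathbb C^k/\mathfrak S_k$ be the $k$-th symmetric product and let $E_k\colon \mathfrak{gl}(V)\to S^k\mathbb C$ send $B$ to the set of its eigenvalues counted with (algebraic) multiplicities. For finite-dimensional $V,W$ put $$\mathbf M_{V,W}=\mathrm{End}(V)^{\oplus 2}\oplus \mathrm{Hom}(W,V)\oplus \mathrm{Hom}(V,W),\qquad \mu(B_1,B_2,i,j)=[B_1,B_2]+ij .$$ (1) If $\dim V=k\ge 0$ and $\dim W\ge 1$, then the morphism of varieties $$\mathbf M_{V,W}\to \mathfrak{gl}(V)\times S^k\mathbb C,\qquad x=(B_1,B_2,i,j)\mapsto (\mu(x),E_k(B_1))$$ is flat. (2) Let $V$ be an orthogonal vector space of dimension $k\ge 0$ (equipped with a nondegenerate symmetric bilinear form) and $W$ a symplectic vector space (equipped with a nondegenerate alternating bilinear form), where $W=0$ is allowed. Put $\mathfrak g(V)=\{A\in\mathfrak{gl}(V): (Av,v')_V=-(v,Av')_V \text{ for all } v,v'\in V\}$ and $$\mathbf N_{V,W}=\{(B_1,B_2,i,j)\in\mathbf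 M_{V,W} : B_1=B_1^*,\ B_2=B_2^*,\ j=i^*\},$$ where $B_l^*$ is the adjoint of $B_l$ with respect to $(\,,\,)_V$, and $i^*\in\mathrm{Hom}(V,W)$ is defined by $(w,i^*v)_W=(iw,v)_V$ for all $v\in V$, $w\in W$. Then the restricted morphism $$\mathbf N_{V,W}\to \mathfrak g(V)\times S^k\mathbb C,\qquad x\mapsto(\mu(x),E_k(B_1))$$ is also flat. -/

import Mathlib

universe u

/-! ### Affine varieties over `ℂ`, given by their closed points and regular functions

An affine variety over `ℂ` with set of closed points `X` is presented by its coordinate ring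
`𝒪 : Subalgebra ℂ (X → ℂ)` of regular functions; the associated scheme is `Spec 𝒪`. A morphism
of such varieties is a map of closed points that pulls regular functions back to regular
functions. -/

section Varieties

variable {X Y : Type u}

/-- Pull-back of functions along a map of sets. -/
def pullbackFun {X Y : Type*} (φ : X → Y) : (Y → ℂ) →ₐ[ℂ] (X → ℂ) where
  toFun f := f ∘ φ
  map_one' := rfl
  map_mul' _ _ := rfl
  map_zero' := rfl
  map_add' _ _ := rfl
  commutes' _ := rfl

/-- The coordinate ring of a finite-dimensional complex vector space `X`, regarded as an affine
space: the algebra of polynomial functions, generated by the linear forms. -/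
def polyFun (X : Type*) [AddCommGroup X] [Module ℂ X] : Subalgebra ℂ (X → ℂ) :=
  Algebra.adjoin ℂ (Set.range fun l : Module.Dual ℂ X => (l : X → ℂ))

/-- The quotient map `ℂᵏ → Sᵏℂ` sending `(z₁, …, z_k)` to the multiset `{z₁, …, z_k}`. -/
def symMk (k : ℕ) (z : Fin k → ℂ) : Sym ℂ k :=
  ⟨Finset.univ.val.map z, by simp⟩

/-- The coordinate ring of the symmetric product `Sᵏℂ = ℂᵏ / 𝔖_k`: the functions on multisets of
size `k` whose pull-back to `ℂᵏ` is polynomial. Via pull-back this is the ring of symmetric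
polynomials in `k` variables, so `Sᵏℂ` is the quotient of `ℂᵏ` by the symmetric group. -/
def symFun (k : ℕ) : Subalgebra ℂ (Sym ℂ k → ℂ) :=
  (polyFun (Fin k → ℂ)).comap (pullbackFun (symMk k))

/-- The coordinate ring of the product of two affine varieties: it is generated by the pull-backs
of the regular functions on the two factors (this algebra of functions on `X × Y` is isomorphic to
the tensor product of the two coordinate rings). -/
def prodFun {X Y : Type*} (A : Subalgebra ℂ (X → ℂ)) (B : Subalgebra ℂ (Y → ℂ)) :
    Subalgebra ℂ (X × Y → ℂ) :=
  A.map (pullbackFun Prod.fst) ⊔ B.map (pullbackFun Prod.snd)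

/-- `φ` is a morphism of affine varieties `(X, A) → (Y, B)`. -/
def IsMorphism (A : Subalgebra ℂ (X → ℂ)) (B : Subalgebra ℂ (Y → ℂ)) (φ : X → Y) : Prop :=
  ∀ f ∈ B, f ∘ φ ∈ A

/-- The comorphism `φ^* : B → A` of a morphism of affine varieties. -/
def comorphism {A : Subalgebra ℂ (X → ℂ)} {B : Subalgebra ℂ (Y → ℂ)} {φ : X → Y}
    (h : IsMorphism A B φ) : B →ₐ[ℂ] A :=
  ((pullbackFun φ).comp B.val).codRestrict A fun f => h f f.2

/-- The morphism of schemes `Spec A ⟶ Spec B` attached to a morphism of affine varieties. -/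
noncomputable def schemeMap {A : Subalgebra ℂ (X → ℂ)} {B : Subalgebra ℂ (Y → ℂ)} {φ : X → Y}
    (h : IsMorphism A B φ) :
    AlgebraicGeometry.Spec (CommRingCat.of A) ⟶ AlgebraicGeometry.Spec (CommRingCat.of B) :=
  AlgebraicGeometry.Spec.map (CommRingCat.ofHom (comorphism h).toRingHom)

/-- `φ` is a morphism of affine varieties `(X, A) → (Y, B)`, and it is flat. -/
def IsFlatMorphism (A : Subalgebra ℂ (X → ℂ)) (B : Subalgebra ℂ (Y → ℂ)) (φ : X → Y) : Prop :=
  ∃ h : IsMorphism A B φ, AlgebraicGeometry.Flat (schemeMap h)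

end Varieties

/-! ### ADHM data -/

section ADHM

variable (V W : Type u) [AddCommGroup V] [Module ℂ V] [AddCommGroup W] [Module ℂ W]

/-- The space `M_{V,W} = End(V)² ⊕ Hom(W,V) ⊕ Hom(V,W)` of quadruples `(B₁, B₂, i, j)`. -/
abbrev ADHMSpace : Type u :=
  Module.End ℂ V × Module.End ℂ V × (W →ₗ[ℂ] V) × (V →ₗ[ℂ] W)

variable {V W}

/-- The moment map `(B₁, B₂, i, j) ↦ [B₁, B₂] + i j`. -/
def momentMap (x : ADHMSpace V W) : Module.End ℂ V :=
  (x.1 * x.2.1 - x.2.1 * x.1) + x.2.2.1 ∘ₗ x.2.2.2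

/-- `E_k : 𝔤𝔩(V) → Sᵏℂ`, `k = dim V`: the eigenvalues of `B` with algebraic multiplicities. -/
noncomputable def eigenvalueMap [FiniteDimensional ℂ V] (B : Module.End ℂ V) :
    Sym ℂ (Module.finrank ℂ V) :=
  ⟨B.charpoly.roots, by
    rw [IsAlgClosed.card_roots_eq_natDegree, LinearMap.charpoly_natDegree]⟩

/-- The map `M_{V,W} → 𝔤𝔩(V) × Sᵏℂ`, `x ↦ (μ(x), E_k(B₁))`. -/
noncomputable def adhmMap [FiniteDimensional ℂ V] (x : ADHMSpace V W) :
    Module.End ℂ V × Sym ℂ (Module.finrank ℂ V) :=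
  (momentMap x, eigenvalueMap x.1)

/-- The subspace `N_{V,W} ⊆ M_{V,W}` cut out by `B₁ = B₁^*`, `B₂ = B₂^*`, `j = i^*` for bilinear
forms on `V` and `W`. The adjoint `i^* : V → W` of `i : W → V` is determined by
`(w, i^* v)_W = (i w, v)_V` for all `v`, `w`. -/
def selfAdjointSpace (βV : LinearMap.BilinForm ℂ V) (βW : LinearMap.BilinForm ℂ W) :
    Submodule ℂ (ADHMSpace V W) where
  carrier := {x | x.1 ∈ βV.selfAdjointSubmodule ∧ x.2.1 ∈ βV.selfAdjointSubmodule ∧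
    LinearMap.IsAdjointPair βW βV x.2.2.1 x.2.2.2}
  add_mem' := by
    rintro x y ⟨hx₁, hx₂, hx₃⟩ ⟨hy₁, hy₂, hy₃⟩
    exact ⟨add_mem hx₁ hy₁, add_mem hx₂ hy₂, fun w v => by simp [hx₃ w v, hy₃ w v]⟩
  zero_mem' := ⟨zero_mem _, zero_mem _, fun w v => by simp⟩
  smul_mem' := by
    rintro c x ⟨hx₁, hx₂, hx₃⟩
    exact ⟨Submodule.smul_mem _ c hx₁, Submodule.smul_mem _ c hx₂,
      fun w v => by simp [hx₃ w v]⟩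

/-- On `N_{V,W}` the moment map takes values in `𝔤(V) = {A | (A v, v') = -(v, A v')}`, the Lie
algebra of the group of linear automorphisms of `V` preserving the form. -/
theorem momentMap_mem_skewAdjoint {βV : LinearMap.BilinForm ℂ V} {βW : LinearMap.BilinForm ℂ W}
    (hV : βV.IsSymm) (hW : βW.IsAlt) {x : ADHMSpace V W} (hx : x ∈ selfAdjointSpace βV βW) :
    momentMap x ∈ βV.skewAdjointSubmodule := by
  obtain ⟨h₁, h₂, h₃⟩ := hx
  rw [LinearMap.mem_selfAdjointSubmodule] at h₁ h₂
  have h₁ : ∀ v v', βV (x.1 v) v' = βV v (x.1 v') := h₁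
  have h₂ : ∀ v v', βV (x.2.1 v) v' = βV v (x.2.1 v') := h₂
  have h₃ : ∀ w v, βV (x.2.2.1 w) v = βW w (x.2.2.2 v) := h₃
  rw [LinearMap.mem_skewAdjointSubmodule]
  intro v v'
  have e : βV v (x.2.2.1 (x.2.2.2 v')) = βW (x.2.2.2 v') (x.2.2.2 v) := by
    rw [hV.eq v, h₃]
  have n : βW (x.2.2.2 v) (x.2.2.2 v') = -βW (x.2.2.2 v') (x.2.2.2 v) :=
    neg_eq_iff_eq_neg.mp (LinearMap.IsAlt.neg hW _ _)
  simp only [momentMap, LinearMap.add_apply, LinearMap.sub_apply, Module.End.mul_apply,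
    LinearMap.comp_apply, map_add, map_sub, Pi.neg_apply, map_neg, h₁, h₂,
    h₃, e, n]
  ring

/-- The map `N_{V,W} → 𝔤(V) × Sᵏℂ`, `x ↦ (μ(x), E_k(B₁))`, for an orthogonal vector space `V` and
a symplectic vector space `W`: the restriction of `adhmMap` to `N_{V,W}`. -/
noncomputable def spMap [FiniteDimensional ℂ V]
    {βV : LinearMap.BilinForm ℂ V} {βW : LinearMap.BilinForm ℂ W}
    (hV : βV.IsSymm) (hW : βW.IsAlt) (x : selfAdjointSpace βV βW) :
    βV.skewAdjointSubmodule × Sym ℂ (Module.finrank ℂ V) :=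
  (⟨momentMap x.1, momentMap_mem_skewAdjoint hV hW x.2⟩, eigenvalueMap x.1.1)

end ADHM

/-! The ring of symmetric functions on `ℂᵏ` is a polynomial ring, so both maps go from one affine
space to another. Their components are homogeneous of positive degree: entries of the moment map, of
degree 2, and coefficients of the characteristic polynomial of `B₁`. If such components form a
regular sequence, the source ring is free over the target ring
(`flat_and_injective_of_isWeaklyRegular`). They form one once their common zero locus has the
expected dimension, by the Cohen-Macaulay property of polynomial rings
(`isWeaklyRegular_of_parameters`, `isWeaklyRegular_of_ringKrullDim_le`). Linear forms may be added
to the list, because a prefix of a regular sequence is regular.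

The dimension bound is symplectic. The linear forms reduce to a space with canonical coordinates
`p`, `q`, where `q` describes pairs (matrix, vector) in (1) and symmetric matrices in (2). On the
zero locus the Liouville form `θ = ∑ p dq` vanishes, so every irreducible closed subset is isotropic
and has dimension at most the number of the `q` (`card_le_of_liouville_eq_zero`).

The form `θ` vanishes because `B₁` is nilpotent there, pairs of a nilpotent matrix and a vector can
only move along orbits of the general linear group, and the vanishing of the moment map makes the
covector conormal to the orbit (`liouville_eq_zero_of_moment_eq_zero`). No orbits are counted. The
argument runs over the function field `K` of a subvariety: a derivation of `K` moves the pair by an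
explicit matrix `ξ`, obtained from a connection on the `K[X]`-module `Kⁿ` that kills the given
vector.

In (1) the linear section keeps one basis vector of `W`; in (2) it sets `i = 0`. -/

section

open RingTheory.Sequence

/-! ### Systems of parameters in Noetherian local rings -/

section LocalExchange

variable {S : Type*} [CommRing S] [IsNoetherianRing S] [IsLocalRing S]

open IsLocalRing

/-- If `S / (J, a)` is supported at the closed point, the same holds for `S / (J, c)` as soon as `c`
avoids the minimal primes of `J` other than the maximal ideal. -/
theorem eq_maximalIdeal_of_exchange {J : Ideal S} {a c : S} (ha : a ∈ maximalIdeal S)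
    (hJa : ∀ p : Ideal S, p.IsPrime → J ≤ p → a ∈ p → p = maximalIdeal S)
    (hc : ∀ q ∈ J.minimalPrimes, q ≠ maximalIdeal S → c ∉ q)
    (p : Ideal S) (hp : p.IsPrime) (hJp : J ≤ p) (hcp : c ∈ p) : p = maximalIdeal S := by
  obtain ⟨q, hq, hqp⟩ := Ideal.exists_minimalPrimes_le hJp
  have hqprime : q.IsPrime := hq.isPrime
  by_cases hqm : q = maximalIdeal S
  · exact le_antisymm (le_maximalIdeal hp.ne_top) (hqm ▸ hqp)
  have hlt : q < p := lt_of_le_of_ne hqp fun h => hc q hq hqm (h ▸ hcp)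
  by_contra hpm
  have hpm' : p < maximalIdeal S := lt_of_le_of_ne (le_maximalIdeal hp.ne_top) hpm
  -- In `S ⧸ q` the maximal ideal is minimal over the image of `a`, so it has height at most one by
  -- Krull's principal ideal theorem. The chain `q < p < maximalIdeal S` contradicts this.
  have hmin : maximalIdeal S ∈ (q ⊔ Ideal.span {a}).minimalPrimes := by
    refine ⟨⟨inferInstance, sup_le (le_maximalIdeal hqprime.ne_top)
      ((Ideal.span_singleton_le_iff_mem _).2 ha)⟩, fun r hr _ => ?_⟩
    exact (hJa r hr.1 (hq.1.2.trans (le_sup_left.trans hr.2))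
      (hr.2 (Ideal.mem_sup_right (Ideal.mem_span_singleton_self a)))).ge
  have h1 := Ideal.map_height_le_one_of_mem_minimalPrimes hmin
  have hker : RingHom.ker (Ideal.Quotient.mk q) = q := Ideal.mk_ker
  have hs : Function.Surjective (Ideal.Quotient.mk q) := Ideal.Quotient.mk_surjective
  have comap_map (r : Ideal S) (h : q ≤ r) :
      (r.map (Ideal.Quotient.mk q)).comap (Ideal.Quotient.mk q) = r := by
    rw [Ideal.comap_map_of_surjective _ hs, ← RingHom.ker_eq_comap_bot, hker, sup_eq_left.2 h]
  have mono {r r' : Ideal S} (h : q ≤ r) (h' : r < r') :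
      r.map (Ideal.Quotient.mk q) < r'.map (Ideal.Quotient.mk q) := by
    refine lt_of_le_of_ne (Ideal.map_mono h'.le) fun e => h'.ne ?_
    rw [← comap_map r h, e, comap_map r' (h.trans h'.le)]
  have pr (r : Ideal S) (hr : r.IsPrime) (h : q ≤ r) : (r.map (Ideal.Quotient.mk q)).IsPrime :=
    Ideal.map_isPrime_of_surjective hs (hker.trans_le h)
  have := pr q hqprime le_rfl
  have := pr p hp hqp
  have := pr _ (inferInstance : (maximalIdeal S).IsPrime) (hqp.trans hpm'.le)
  have h2 := Ideal.height_add_one_le_of_lt_of_isPrime (mono le_rfl hlt)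
  have h3 := Ideal.height_add_one_le_of_lt_of_isPrime (mono hqp hpm')
  have h4 : (1 : ℕ∞) + 1 ≤ 1 :=
    ((add_le_add_left (le_add_self.trans h2) 1).trans h3).trans h1
  exact absurd h4 (by decide)

/-- A module with a nonzerodivisor in the maximal ideal has only nonzerodivisors among the elements
that cut out the closed point on its support. -/
theorem isSMulRegular_of_exists_regular {M : Type*} [AddCommGroup M] [Module S M]
    {b c : S} (hcm : c ∈ maximalIdeal S) (hc : IsSMulRegular M c)
    (hb : ∀ p : Ideal S, p.IsPrime → Module.annihilator S M ≤ p → b ∈ p → p = maximalIdeal S) :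
    IsSMulRegular M b := by
  rw [isSMulRegular_iff_torsionBy_eq_bot]
  by_contra hne
  have : Nontrivial (Submodule.torsionBy S M b) := (Submodule.nontrivial_iff_ne_bot).2 hne
  -- An associated prime of the `b`-torsion contains `b` and the annihilator of `M`, hence is the
  -- maximal ideal. It then contains `c`, which would kill a nonzero vector.
  obtain ⟨p, hp⟩ := associatedPrimes.nonempty S (Submodule.torsionBy S M b)
  obtain ⟨hpp, x, hx⟩ := isAssociatedPrime_iff.1 hp
  have hmem (r : S) : r ∈ p ↔ r • (x : M) = 0 := by
    rw [hx, Submodule.mem_colon_singleton, Submodule.mem_bot, Subtype.ext_iff]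
    rfl
  have hpm : p = maximalIdeal S :=
    hb p hpp (fun r hr => (hmem r).2 (Module.mem_annihilator.1 hr _)) ((hmem b).2 x.2)
  have hx0 : (x : M) = 0 := hc <| by
    simpa using (hmem c).1 (hpm ▸ hcm)
  exact hpp.ne_top ((Ideal.eq_top_iff_one _).2 ((hmem 1).2 (by rw [hx0, smul_zero])))

theorem annihilator_sup_le_annihilator_quotient {S M : Type*} [CommRing S] [AddCommGroup M]
    [Module S M] (I : Ideal S) : Module.annihilator S M ⊔ I ≤
      Module.annihilator S (M ⧸ (I • ⊤ : Submodule S M)) := by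
  refine sup_le (fun r hr => ?_) fun r hr => ?_
  · rw [Module.mem_annihilator] at hr ⊢
    intro m
    obtain ⟨m, rfl⟩ := Submodule.Quotient.mk_surjective _ m
    rw [← Submodule.Quotient.mk_smul, hr, Submodule.Quotient.mk_zero]
  · rw [Module.mem_annihilator]
    intro m
    obtain ⟨m, rfl⟩ := Submodule.Quotient.mk_surjective _ m
    rw [← Submodule.Quotient.mk_smul, Submodule.Quotient.mk_eq_zero]
    exact Submodule.smul_mem_smul hr trivial

theorem ofList_le_iff {R : Type*} [CommRing R] {l : List R} {p : Ideal R} :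
    Ideal.ofList l ≤ p ↔ ∀ a ∈ l, a ∈ p := Ideal.span_le

/-- In a Noetherian local ring, a system of parameters of a finite module which admits a regular
system of parameters is regular. -/
theorem isWeaklyRegular_of_parameters (n : ℕ) : ∀ (M : Type*) [AddCommGroup M] [Module S M]
    [Module.Finite S M] (as bs : List S), as.length = n → bs.length = n →
    (∀ a ∈ as, a ∈ maximalIdeal S) → (∀ b ∈ bs, b ∈ maximalIdeal S) → IsWeaklyRegular M as →
    (∀ p : Ideal S, p.IsPrime → Module.annihilator S M ≤ p → (∀ a ∈ as, a ∈ p) →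
      p = maximalIdeal S) →
    (∀ p : Ideal S, p.IsPrime → Module.annihilator S M ≤ p → (∀ b ∈ bs, b ∈ p) →
      p = maximalIdeal S) →
    IsWeaklyRegular M bs := by
  induction n with
  | zero =>
    intro M _ _ _ as bs _ hbs _ _ _ _ _
    rw [List.length_eq_zero_iff.1 hbs]
    exact .nil S M
  | succ n ih =>
    intro M _ _ _ as bs has hbs hma hmb hreg hVa hVb
    obtain ⟨as', a, rfl⟩ := List.eq_nil_or_concat' as |>.resolve_left (by rintro rfl; simp at has)
    obtain ⟨bs', b, rfl⟩ := List.eq_nil_or_concat' bs |>.resolve_left (by rintro rfl; simp at hbs)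
    simp only [List.length_append, List.length_cons, List.length_nil, zero_add,
      Nat.add_right_cancel_iff] at has hbs
    simp only [List.mem_append, List.mem_singleton] at hma hmb hVa hVb
    set Ja := Module.annihilator S M ⊔ Ideal.ofList as' with hJa
    set Jb := Module.annihilator S M ⊔ Ideal.ofList bs' with hJb
    have hfin : (Ja.minimalPrimes ∪ Jb.minimalPrimes).Finite :=
      (Ideal.finite_minimalPrimes_of_isNoetherianRing S Ja).union
        (Ideal.finite_minimalPrimes_of_isNoetherianRing S Jb)
    -- Prime avoidance gives one `c` completing both truncated systems. Then `a` is exchanged for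
    -- `c`, the induction hypothesis is applied to `M / cM`, and `c` is exchanged for `b`; permuting
    -- regular sequences is allowed over a local ring.
    obtain ⟨c, hcm, hc⟩ : ∃ c ∈ maximalIdeal S,
        ∀ q ∈ Ja.minimalPrimes ∪ Jb.minimalPrimes, q ≠ maximalIdeal S → c ∉ q := by
      classical
      by_contra! h
      have hsub : ((maximalIdeal S : Ideal S) : Set S) ⊆
          ⋃ i ∈ ((hfin.toFinset.filter (· ≠ maximalIdeal S) : Finset (Ideal S)) : Set (Ideal S)),
            ((id i : Ideal S) : Set S) := by
        intro x hx
        obtain ⟨q, hq, hqm, hxq⟩ := h x hx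
        simp only [Set.mem_iUnion]
        exact ⟨q, by simp only [Finset.coe_filter, Set.Finite.mem_toFinset]; exact ⟨hq, hqm⟩, hxq⟩
      rw [Ideal.subset_union_prime ⊥ ⊥] at hsub
      · obtain ⟨q, hq, hle⟩ := hsub
        simp only [Finset.mem_filter, Set.Finite.mem_toFinset] at hq
        have hqp : q.IsPrime := by
          rcases hq.1 with h | h <;> exact h.isPrime
        exact hq.2 (le_antisymm (le_maximalIdeal hqp.ne_top) hle)
      · intro q hq _ _
        simp only [Finset.mem_filter, Set.Finite.mem_toFinset] at hq
        rcases hq.1 with h | h <;> exact h.isPrime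
    have hVac : ∀ p : Ideal S, p.IsPrime → Ja ≤ p → c ∈ p → p = maximalIdeal S := by
      refine fun p => eq_maximalIdeal_of_exchange (hma a (.inr rfl)) (fun p hp hle hap => ?_)
        (fun q hq => hc q (.inl hq)) p
      refine hVa p hp (le_sup_left.trans hle) ?_
      rintro x (hx | rfl)
      · exact ofList_le_iff.1 (le_sup_right.trans hle) x hx
      · exact hap
    have hVbc : ∀ p : Ideal S, p.IsPrime → Jb ≤ p → c ∈ p → p = maximalIdeal S := by
      refine fun p => eq_maximalIdeal_of_exchange (hmb b (.inr rfl)) (fun p hp hle hap => ?_)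
        (fun q hq => hc q (.inr hq)) p
      refine hVb p hp (le_sup_left.trans hle) ?_
      rintro x (hx | rfl)
      · exact ofList_le_iff.1 (le_sup_right.trans hle) x hx
      · exact hap
    rw [isWeaklyRegular_append_iff, isWeaklyRegular_singleton_iff] at hreg ⊢
    have hreg2 : IsSMulRegular (M ⧸ (Ideal.ofList as' • ⊤ : Submodule S M)) c :=
      isSMulRegular_of_exists_regular (hma a (.inr rfl)) hreg.2 fun p hp hle hcp =>
        hVac p hp ((annihilator_sup_le_annihilator_quotient _).trans hle) hcp
    have hac : IsWeaklyRegular M (as' ++ [c]) := by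
      rw [isWeaklyRegular_append_iff, isWeaklyRegular_singleton_iff]
      exact ⟨hreg.1, hreg2⟩
    have hca : IsWeaklyRegular M (c :: as') :=
      IsLocalRing.isWeaklyRegular_of_perm_of_subset_maximalIdeal hac
        (List.perm_append_singleton c as') (by
          simp only [List.mem_append, List.mem_singleton]
          rintro r (hr | rfl)
          · exact hma r (.inl hr)
          · exact hcm)
    rw [isWeaklyRegular_cons_iff] at hca
    have hann : Module.annihilator S M ⊔ Ideal.span {c} ≤
        Module.annihilator S (QuotSMulTop c M) := by
      refine sup_le (fun r hr => ?_) ?_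
      · rw [Module.mem_annihilator] at hr ⊢
        intro m
        obtain ⟨m, rfl⟩ := Submodule.Quotient.mk_surjective _ m
        rw [← Submodule.Quotient.mk_smul, hr, Submodule.Quotient.mk_zero]
      · rw [Ideal.span_singleton_le_iff_mem, Module.mem_annihilator]
        intro m
        obtain ⟨m, rfl⟩ := Submodule.Quotient.mk_surjective _ m
        rw [← Submodule.Quotient.mk_smul, Submodule.Quotient.mk_eq_zero]
        exact Submodule.smul_mem_pointwise_smul _ _ _ trivial
    have hb' : IsWeaklyRegular (QuotSMulTop c M) bs' := by
      refine ih (QuotSMulTop c M) as' bs' has hbs (fun a ha => hma a (.inl ha))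
        (fun a ha => hmb a (.inl ha)) hca.2 (fun p hp hle hap => ?_) fun p hp hle hap => ?_
      · exact hVac p hp (sup_le ((le_sup_left.trans hann).trans hle) (ofList_le_iff.2 hap))
          (hle (hann (Ideal.mem_sup_right (Ideal.mem_span_singleton_self c))))
      · exact hVbc p hp (sup_le ((le_sup_left.trans hann).trans hle) (ofList_le_iff.2 hap))
          (hle (hann (Ideal.mem_sup_right (Ideal.mem_span_singleton_self c))))
    have hcb : IsWeaklyRegular M (c :: bs') := by
      rw [isWeaklyRegular_cons_iff]
      exact ⟨hca.1, hb'⟩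
    have hbc : IsWeaklyRegular M (bs' ++ [c]) :=
      IsLocalRing.isWeaklyRegular_of_perm_of_subset_maximalIdeal hcb
        (List.perm_append_singleton c bs').symm (by
          simp only [List.mem_cons]
          rintro r (rfl | hr)
          · exact hcm
          · exact hmb r (.inl hr))
    rw [isWeaklyRegular_append_iff, isWeaklyRegular_singleton_iff] at hbc
    exact ⟨hbc.1, isSMulRegular_of_exists_regular hcm hbc.2 fun p hp hle hbp =>
      hVb p hp (le_sup_left.trans ((annihilator_sup_le_annihilator_quotient _).trans hle)) (by
        rintro x (hx | rfl)
        · exact ofList_le_iff.1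
            (le_sup_right.trans ((annihilator_sup_le_annihilator_quotient _).trans hle)) x hx
        · exact hbp)⟩

end LocalExchange

end

/-! ### Derivations of function fields and isotropic subspaces -/

section

open MvPolynomial

/-- Incomparability: strict inclusions of primes stay strict after contraction along an integral
extension. -/
theorem ringKrullDim_le_of_isIntegral (A B : Type*) [CommRing A] [CommRing B] [Algebra A B]
    [Algebra.IsIntegral A B] : ringKrullDim B ≤ ringKrullDim A := by
  refine Order.krullDim_le_of_strictMono
    (fun p : PrimeSpectrum B => PrimeSpectrum.comap (algebraMap A B) p) fun p q hpq => ?_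
  exact Ideal.IsIntegral.comap_lt_comap (I := p.asIdeal) (J := q.asIdeal) hpq

/-- Over a field of characteristic zero the partial derivatives with respect to a transcendence
basis extend to the whole field. -/
theorem exists_derivation_dual_basis {k K ι : Type*} [Field k] [CharZero k] [Field K] [Algebra k K]
    {t : ι → K} (ht : AlgebraicIndependent k t)
    (halg : ∀ x : K, ∃ p : Polynomial (MvPolynomial ι k), p ≠ 0 ∧
      p.eval₂ (aeval t : MvPolynomial ι k →ₐ[k] K).toRingHom x = 0) (i : ι) :
    ∃ D : Derivation k K K, D (t i) = 1 ∧ ∀ j ≠ i, D (t j) = 0 := by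
  classical
  let _ : Algebra (MvPolynomial ι k) K := (aeval t : MvPolynomial ι k →ₐ[k] K).toRingHom.toAlgebra
  have hmap (p : MvPolynomial ι k) : algebraMap (MvPolynomial ι k) K p = aeval t p := rfl
  have : IsScalarTower k (MvPolynomial ι k) K := .of_algebraMap_eq fun x => by simp [hmap]
  have : FaithfulSMul (MvPolynomial ι k) K := (faithfulSMul_iff_algebraMap_injective _ _).2 ht
  have : Algebra.IsAlgebraic (MvPolynomial ι k) K := ⟨fun x => by
    obtain ⟨p, hp, h⟩ := halg x
    exact ⟨p, hp, h⟩⟩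
  let F := FractionRing (MvPolynomial ι k)
  let _ : Algebra F K := FractionRing.liftAlgebra (MvPolynomial ι k) K
  have : IsScalarTower (MvPolynomial ι k) F K := FractionRing.isScalarTower_liftAlgebra _ _
  have : Algebra.IsAlgebraic F K := 
    (IsFractionRing.comap_isAlgebraic_iff (A := MvPolynomial ι k)).1 inferInstance
  have : CharZero F := charZero_of_injective_algebraMap (algebraMap k F).injective
  -- In characteristic zero the algebraic extension `K / F` is separable, hence formally étale, and
  -- so is the localization `F`. Therefore the differentials of `K` are the base change of those of
  -- the polynomial ring, and `d` extends to `K`.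
  have : Algebra.FormallyEtale F K := Algebra.FormallyEtale.of_isSeparable F K
  have : Algebra.FormallyEtale (MvPolynomial ι k) F :=
    Algebra.FormallyEtale.of_isLocalization (nonZeroDivisors (MvPolynomial ι k))
  have : Algebra.FormallyEtale (MvPolynomial ι k) K :=
    Algebra.FormallyEtale.comp (MvPolynomial ι k) F K
  let d : Derivation k (MvPolynomial ι k) K := mkDerivation k (Pi.single i 1)
  have hb := KaehlerDifferential.isBaseChange_of_formallyEtale k (MvPolynomial ι k) K
  let L := hb.lift d.liftKaehlerDifferential
  have hL (j : ι) : L (KaehlerDifferential.D k K (t j)) = (Pi.single i 1 : ι → K) j := by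
    have h1 : KaehlerDifferential.D k K (t j) =
        KaehlerDifferential.map k k (MvPolynomial ι k) K
          (KaehlerDifferential.D k (MvPolynomial ι k) (X j)) := by
      rw [KaehlerDifferential.map_D, hmap, aeval_X]
    rw [h1, hb.lift_eq, Derivation.liftKaehlerDifferential_comp_D]
    exact mkDerivation_X _ _ _
  refine ⟨L.compDer (KaehlerDifferential.D k K), ?_, fun j hj => ?_⟩
  · exact (hL i).trans (Pi.single_eq_same _ _)
  · exact (hL j).trans (Pi.single_eq_of_ne hj _)

/-- A finitely generated domain `A` over a field of characteristic zero has, on its fraction field,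
at least `dim A` derivations that are dual to some elements. -/
theorem exists_derivations_of_finiteType {k A K : Type*} [Field k] [CharZero k] [CommRing A]
    [IsDomain A] [Algebra k A] [Algebra.FiniteType k A] [Field K] [Algebra A K]
    [IsFractionRing A K] [Algebra k K] [IsScalarTower k A K] :
    ∃ s : ℕ, ringKrullDim A ≤ s ∧ ∃ (t : Fin s → K) (D : Fin s → Derivation k K K),
      ∀ i, D i (t i) = 1 ∧ ∀ j ≠ i, D i (t j) = 0 := by
  -- Noether normalization: integrality bounds the dimension of `A` by the number of variables, and
  -- the images of the variables serve as the `t i`.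
  obtain ⟨s, g, hg, hint⟩ := exists_integral_inj_algHom_of_fg k A
  refine ⟨s, ?_, fun i => algebraMap A K (g (X i)), ?_⟩
  · let _ : Algebra (MvPolynomial (Fin s) k) A := g.toRingHom.toAlgebra
    have : Algebra.IsIntegral (MvPolynomial (Fin s) k) A := ⟨hint⟩
    refine (ringKrullDim_le_of_isIntegral (MvPolynomial (Fin s) k) A).trans ?_
    rw [MvPolynomial.ringKrullDim_of_isNoetherianRing, ringKrullDim_eq_zero_of_field]
    simp
  · have haeval : (aeval fun i => algebraMap A K (g (X i)) : MvPolynomial (Fin s) k →ₐ[k] K) =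
        (IsScalarTower.toAlgHom k A K).comp g := by
      ext i
      simp
    have ht : AlgebraicIndependent k fun i => algebraMap A K (g (X i)) := by
      rw [AlgebraicIndependent, haeval]
      exact (IsFractionRing.injective A K).comp hg
    have halg : ∀ x : K, ∃ p : Polynomial (MvPolynomial (Fin s) k), p ≠ 0 ∧
        p.eval₂ (aeval fun i => algebraMap A K (g (X i)) :
          MvPolynomial (Fin s) k →ₐ[k] K).toRingHom x = 0 := by
      let _ : Algebra (MvPolynomial (Fin s) k) A := g.toRingHom.toAlgebra
      let _ : Algebra (MvPolynomial (Fin s) k) K := ((algebraMap A K).comp g.toRingHom).toAlgebra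
      have : IsScalarTower (MvPolynomial (Fin s) k) A K := .of_algebraMap_eq fun x => rfl
      have : Algebra.IsIntegral (MvPolynomial (Fin s) k) A := ⟨hint⟩
      have : Algebra.IsAlgebraic A K := IsFractionRing.comap_isAlgebraic_iff (K := K).2 inferInstance
      have : Algebra.IsAlgebraic (MvPolynomial (Fin s) k) K :=
        Algebra.IsAlgebraic.trans (MvPolynomial (Fin s) k) A K
      intro x
      obtain ⟨p, hp, h⟩ := Algebra.IsAlgebraic.isAlgebraic (R := MvPolynomial (Fin s) k) x
      refine ⟨p, hp, ?_⟩
      rw [haeval]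
      exact h
    choose D hD using exists_derivation_dual_basis ht halg
    exact ⟨D, hD⟩

/-- The standard symplectic form on `(κ → K) × (κ → K)`. -/
def symplecticForm (K κ : Type*) [Field K] [Fintype κ] :
    LinearMap.BilinForm K ((κ → K) × (κ → K)) :=
  LinearMap.mk₂ K (fun u v => u.1 ⬝ᵥ v.2 - u.2 ⬝ᵥ v.1)
    (fun u u' v => by simp only [Prod.fst_add, Prod.snd_add, add_dotProduct]; ring)
    (fun c u v => by
      simp only [Prod.smul_fst, Prod.smul_snd, smul_dotProduct, smul_eq_mul]; ring)
    (fun u v v' => by simp only [Prod.fst_add, Prod.snd_add, dotProduct_add]; ring)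
    (fun c u v => by
      simp only [Prod.smul_fst, Prod.smul_snd, dotProduct_smul, smul_eq_mul]; ring)

theorem symplecticForm_apply {K κ : Type*} [Field K] [Fintype κ] (u v : (κ → K) × (κ → K)) :
    symplecticForm K κ u v = u.1 ⬝ᵥ v.2 - u.2 ⬝ᵥ v.1 := rfl

theorem symplecticForm_isAlt {K κ : Type*} [Field K] [Fintype κ] :
    (symplecticForm K κ).IsAlt := fun u => by
  rw [symplecticForm_apply, dotProduct_comm, sub_self]

theorem symplecticForm_nondegenerate {K κ : Type*} [Field K] [Fintype κ] :
    (symplecticForm K κ).Nondegenerate := by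
  classical
  refine (LinearMap.IsRefl.nondegenerate_iff_separatingLeft
    (LinearMap.IsAlt.isRefl (B := symplecticForm K κ) symplecticForm_isAlt)).2 fun u hu =>
      Prod.ext (funext fun a => ?_) (funext fun a => ?_)
  · simpa [symplecticForm_apply] using hu (0, Pi.single a 1)
  · simpa [symplecticForm_apply] using hu (Pi.single a 1, 0)

/-- An isotropic subspace for the standard symplectic form has at most half the dimension. -/
theorem finrank_le_of_isotropic {K κ : Type*} [Field K] [Fintype κ]
    (L : Submodule K ((κ → K) × (κ → K)))
    (hL : ∀ u ∈ L, ∀ v ∈ L, symplecticForm K κ u v = 0) :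
    Module.finrank K L ≤ Fintype.card κ := by
  have h1 : L ≤ (symplecticForm K κ).orthogonal L := fun v hv u hu => hL u hu v hv
  have h2 := Submodule.finrank_mono h1
  rw [LinearMap.BilinForm.finrank_orthogonal symplecticForm_nondegenerate] at h2
  simp only [Module.finrank_prod, Module.finrank_fintype_fun_eq_card] at h2
  omega

theorem Derivation.sum_smul_apply {k K ι : Type*} [Field k] [Field K] [Algebra k K] [Fintype ι]
    (c : ι → K) (D : ι → Derivation k K K) (x : K) :
    (∑ i, c i • D i) x = ∑ i, c i * D i x := by
  have h := congrFun (map_sum (Derivation.coeFnAddMonoidHom (R := k) (A := K) (M := K))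
    (fun i => c i • D i) Finset.univ) x
  rw [Finset.sum_apply] at h
  exact h

/-- If the one-form `∑ p dq` vanishes on a field `K` generated by the `p` and `q`, then the number
of independent derivations of `K` is at most the number of the `q`. -/
theorem card_le_of_liouville_eq_zero {k K κ : Type*} [Field k] [Field K] [Algebra k K] [Fintype κ]
    {s : ℕ} {t : Fin s → K} {D : Fin s → Derivation k K K}
    (hD : ∀ i, D i (t i) = 1 ∧ ∀ j ≠ i, D i (t j) = 0) (p q : κ → K)
    (hpq : ∀ E : Derivation k K K, ∑ a, p a * E (q a) = 0)
    (hgen : ∀ E : Derivation k K K, (∀ a, E (p a) = 0) → (∀ a, E (q a) = 0) → E = 0) :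
    s ≤ Fintype.card κ := by
  let Φ : (Fin s → K) →ₗ[K] (κ → K) × (κ → K) :=
    { toFun := fun c => (fun a => (∑ i, c i • D i) (q a), fun a => (∑ i, c i • D i) (p a))
      map_add' := fun c d => by
        ext a <;> simp [add_smul, Finset.sum_add_distrib]
      map_smul' := fun c d => by
        ext a <;> simp only [Pi.smul_apply, smul_eq_mul, mul_smul, ← Finset.smul_sum,
          Derivation.smul_apply, RingHom.id_apply, Prod.smul_mk] }
  have hΦ : Function.Injective Φ := by
    rw [injective_iff_map_eq_zero]
    intro c hc
    have h0 := hgen (∑ i, c i • D i) (fun a => congrFun (congrArg Prod.snd hc) a)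
      (fun a => congrFun (congrArg Prod.fst hc) a)
    funext j
    have h1 := congrArg (fun E : Derivation k K K => E (t j)) h0
    rw [Derivation.sum_smul_apply] at h1
    simp only [Derivation.coe_zero, Pi.zero_apply] at h1
    rwa [Finset.sum_eq_single j (fun i _ hij => by rw [(hD i).2 j hij.symm, mul_zero])
      (by simp), (hD j).1, mul_one] at h1
  have hiso : ∀ u ∈ LinearMap.range Φ, ∀ v ∈ LinearMap.range Φ, symplecticForm K κ u v = 0 := by
    rintro _ ⟨c, rfl⟩ _ ⟨d, rfl⟩
    set E₁ := ∑ i, c i • D i with hE₁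
    set E₂ := ∑ i, d i • D i with hE₂
    -- Cartan's formula for `θ = ∑ p dq`: `dθ(E₁, E₂) = E₁ θ(E₂) - E₂ θ(E₁) - θ(⁅E₁, E₂⁆)`, and all
    -- three terms on the right vanish.
    have e1 := congrArg E₁ (hpq E₂)
    have e2 := congrArg E₂ (hpq E₁)
    have e3 := hpq ⁅E₁, E₂⁆
    rw [map_zero, map_sum] at e1 e2
    simp only [Derivation.leibniz, smul_eq_mul, Finset.sum_add_distrib] at e1 e2
    simp only [Derivation.commutator_apply, mul_sub, Finset.sum_sub_distrib] at e3
    change ∑ a, E₁ (q a) * E₂ (p a) - ∑ a, E₁ (p a) * E₂ (q a) = 0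
    have e4 : ∑ a, E₁ (p a) * E₂ (q a) = ∑ a, E₂ (q a) * E₁ (p a) :=
      Finset.sum_congr rfl fun a _ => mul_comm _ _
    rw [e4]
    linear_combination e3 - e1 + e2
  have := finrank_le_of_isotropic _ hiso
  rwa [LinearMap.finrank_range_of_inj hΦ, Module.finrank_fintype_fun_eq_card,
    Fintype.card_fin] at this

end

/-! ### Connections on torsion `K[X]`-modules and vanishing of the Liouville form -/

section

open Polynomial

section Connection

variable {k K : Type*} [Field k] [Field K] [Algebra k K]

/-- The coefficientwise extension of a derivation of `K` to `K[X]`. -/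
noncomputable def Derivation.polyCoeff (D : Derivation k K K) : Derivation k K[X] K[X] :=
  PolynomialModule.equivPolynomialSelf.compDer D.mapCoeffs

theorem Derivation.polyCoeff_coeff (D : Derivation k K K) (p : K[X]) (i : ℕ) :
    (D.polyCoeff p).coeff i = D (p.coeff i) := rfl

theorem Derivation.polyCoeff_X (D : Derivation k K K) : D.polyCoeff X = 0 := by
  ext i
  rw [Derivation.polyCoeff_coeff, coeff_X]
  split_ifs <;> simp

theorem Derivation.polyCoeff_C (D : Derivation k K K) (c : K) : D.polyCoeff (C c) = C (D c) := by
  ext i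
  rw [Derivation.polyCoeff_coeff, coeff_C, coeff_C]
  split_ifs <;> simp

theorem Derivation.polyCoeff_X_pow (D : Derivation k K K) (e : ℕ) : D.polyCoeff (X ^ e) = 0 := by
  rw [Derivation.leibniz_pow, Derivation.polyCoeff_X, smul_zero, smul_zero]

/-- Every vector of `M` is annihilated by some connection on the `K[X]`-module `M` that lifts the
derivation `D` of `K` and commutes with `X`. -/
def HasHorizontalConnections (D : Derivation k K K) (M : Type*) [AddCommGroup M] [Module K[X] M] :
    Prop :=
  ∀ v : M, ∃ N : M →+ M, (∀ (p : K[X]) (m : M), N (p • m) = D.polyCoeff p • m + p • N m) ∧ N v = 0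

theorem HasHorizontalConnections.of_linearEquiv {D : Derivation k K K} {M M' : Type*}
    [AddCommGroup M] [Module K[X] M] [AddCommGroup M'] [Module K[X] M'] (e : M ≃ₗ[K[X]] M')
    (h : HasHorizontalConnections D M') : HasHorizontalConnections D M := fun v => by
  obtain ⟨N, hN, hv⟩ := h (e v)
  refine ⟨(e.symm.toAddEquiv.toAddMonoidHom.comp N).comp e.toAddEquiv.toAddMonoidHom,
    fun p m => ?_, ?_⟩
  · change e.symm (N (e (p • m))) = _ + p • e.symm (N (e m))
    rw [map_smul, hN, map_add, map_smul, map_smul, e.symm_apply_apply]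
  · change e.symm (N (e v)) = 0
    rw [hv, map_zero]

theorem HasHorizontalConnections.directSum {D : Derivation k K K} {ι : Type*} {M : ι → Type*}
    [∀ i, AddCommGroup (M i)] [∀ i, Module K[X] (M i)]
    (h : ∀ i, HasHorizontalConnections D (M i)) :
    HasHorizontalConnections D (DirectSum ι M) := fun v => by
  choose N hN hv using fun i => h i (v i)
  refine ⟨DFinsupp.mapRange.addMonoidHom N, fun p m => ?_, ?_⟩
  · refine DFinsupp.ext fun i => ?_
    exact hN i p (m i)
  · refine DFinsupp.ext fun i => ?_
    exact hv i

/-- The polynomial `X ^ e` has constant coefficients, so differentiating coefficients descends to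
the quotient, and adding multiplication by a polynomial gives another connection. A nonzero
representative is `X ^ a * u` with `u` prime to `X`, hence invertible modulo `X ^ e`; subtracting
multiplication by `D u / u` makes its class horizontal. -/
theorem hasHorizontalConnections_quotient (D : Derivation k K K) (e : ℕ) :
    HasHorizontalConnections D (K[X] ⧸ Submodule.span K[X] {(X : K[X]) ^ e}) := by
  set I := Submodule.span K[X] {(X : K[X]) ^ e} with hI
  have hmem (p : K[X]) : p ∈ I ↔ X ^ e ∣ p := by
    rw [hI, Submodule.mem_span_singleton]
    exact ⟨fun ⟨a, ha⟩ => ⟨a, by rw [← ha, smul_eq_mul, mul_comm]⟩,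
      fun ⟨a, ha⟩ => ⟨a, by rw [ha, smul_eq_mul, mul_comm]⟩⟩
  have hDI (p : K[X]) (hp : p ∈ I) : D.polyCoeff p ∈ I := by
    rw [hmem] at hp ⊢
    obtain ⟨q, rfl⟩ := hp
    rw [Derivation.leibniz, Derivation.polyCoeff_X_pow, smul_zero, add_zero, smul_eq_mul]
    exact dvd_mul_right _ _
  let N₀ : K[X] ⧸ I →+ K[X] ⧸ I :=
    QuotientAddGroup.map I.toAddSubgroup I.toAddSubgroup D.polyCoeff.toLinearMap.toAddMonoidHom hDI
  have hN₀mk (p : K[X]) : N₀ (Submodule.Quotient.mk p) = Submodule.Quotient.mk (D.polyCoeff p) :=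
    rfl
  have hN₀ (p : K[X]) (m : K[X] ⧸ I) : N₀ (p • m) = D.polyCoeff p • m + p • N₀ m := by
    obtain ⟨m, rfl⟩ := Submodule.Quotient.mk_surjective _ m
    rw [← Submodule.Quotient.mk_smul, hN₀mk, hN₀mk, ← Submodule.Quotient.mk_smul,
      ← Submodule.Quotient.mk_smul, ← Submodule.Quotient.mk_add, smul_eq_mul, Derivation.leibniz]
    simp only [smul_eq_mul]
    rw [add_comm, mul_comm m]
  have hN₁ (c : K[X]) (p : K[X]) (m : K[X] ⧸ I) :
      N₀ (p • m) + c • p • m = D.polyCoeff p • m + p • (N₀ m + c • m) := by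
    rw [hN₀, smul_add, smul_comm c p m, add_assoc]
  intro v
  obtain ⟨v, rfl⟩ := Submodule.Quotient.mk_surjective _ v
  by_cases hv : v = 0
  · exact ⟨N₀, hN₀, by rw [hv, Submodule.Quotient.mk_zero, map_zero]⟩
  obtain ⟨u, hu, hnd⟩ := exists_eq_pow_rootMultiplicity_mul_and_not_dvd v hv 0
  rw [map_zero, sub_zero] at hu hnd
  obtain ⟨a, b, hab⟩ : IsCoprime u (X ^ e) :=
    ((irreducible_X.coprime_iff_not_dvd).2 hnd).symm.pow_right
  refine ⟨N₀ + DistribSMul.toAddMonoidHom _ (-(D.polyCoeff u * a)), hN₁ _, ?_⟩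
  change N₀ (Submodule.Quotient.mk v) + (-(D.polyCoeff u * a)) • Submodule.Quotient.mk v = 0
  rw [hN₀mk, ← Submodule.Quotient.mk_smul, ← Submodule.Quotient.mk_add, Submodule.Quotient.mk_eq_zero,
    hmem, hu, Derivation.leibniz, Derivation.polyCoeff_X_pow, smul_zero, add_zero]
  refine ⟨X ^ rootMultiplicity 0 v * D.polyCoeff u * b, ?_⟩
  simp only [smul_eq_mul]
  linear_combination -(X ^ rootMultiplicity 0 v * D.polyCoeff u) * hab

/-- By the structure theorem over the principal ideal domain `K[X]`, the module is a sum of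
quotients by powers of `X`, and connections may be chosen summand by summand. Torsion by powers of
`X` excludes the other primes, which `D` need not fix. -/
theorem hasHorizontalConnections_of_isTorsion (D : Derivation k K K) (M : Type*) [AddCommGroup M]
    [Module K[X] M] [Module.Finite K[X] M]
    (h : Module.IsTorsion' M (Submonoid.powers (X : K[X]))) : HasHorizontalConnections D M := by
  obtain ⟨d, e, ⟨f⟩⟩ := Module.torsion_by_prime_power_decomposition irreducible_X h
  exact .of_linearEquiv f (.directSum fun i => hasHorizontalConnections_quotient D (e i))

/-- A derivation of `K` moves a pair of a nilpotent matrix and a vector along its orbit under the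
general linear group. -/
theorem exists_matrix_of_isNilpotent {n : Type*} [Fintype n] [DecidableEq n] (D : Derivation k K K)
    {x : Matrix n n K} (hx : IsNilpotent x) (v : n → K) :
    ∃ ξ : Matrix n n K, x.map D = x * ξ - ξ * x ∧ (fun a => D (v a)) = -(ξ.mulVec v) := by
  let φ := Matrix.toLin' x
  have htors : Module.IsTorsion' (Module.AEval' φ) (Submonoid.powers (X : K[X])) := by
    obtain ⟨e, he⟩ := hx
    intro m
    refine ⟨⟨X ^ e, e, rfl⟩, ?_⟩
    obtain ⟨w, rfl⟩ := (Module.AEval'.of φ).surjective m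
    change (X ^ e : K[X]) • Module.AEval'.of φ w = 0
    rw [Module.AEval'.X_pow_smul_of]
    have : φ ^ e = 0 := by rw [← Matrix.toLin'_pow, he, map_zero]
    rw [this, zero_smul, map_zero]
  obtain ⟨N, hN, hNv⟩ :=
    hasHorizontalConnections_of_isTorsion D (Module.AEval' φ) htors (Module.AEval'.of φ v)
  let N' : (n → K) →+ (n → K) :=
    ((Module.AEval'.of φ).symm.toAddEquiv.toAddMonoidHom.comp N).comp
      (Module.AEval'.of φ).toAddEquiv.toAddMonoidHom
  have hN'def (w : n → K) : N' w = (Module.AEval'.of φ).symm (N (Module.AEval'.of φ w)) := rfl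
  have hN'smul (c : K) (w : n → K) : N' (c • w) = D c • w + c • N' w := by
    have h := hN (C c) (Module.AEval'.of φ w)
    rw [Derivation.polyCoeff_C] at h
    have hC (c : K) (m : Module.AEval' φ) : (C c : K[X]) • m = c • m := by
      rw [← algebraMap_eq, algebraMap_smul]
    rw [hC, hC, hC, ← map_smul (Module.AEval'.of φ)] at h
    rw [hN'def, h, map_add, map_smul, map_smul, LinearEquiv.symm_apply_apply, ← hN'def]
  have hN'x (w : n → K) : N' (x.mulVec w) = x.mulVec (N' w) := by
    have h := hN X (Module.AEval'.of φ w)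
    rw [Derivation.polyCoeff_X, zero_smul, zero_add, Module.AEval'.X_smul_of] at h
    have h2 : (X : K[X]) • N (Module.AEval'.of φ w) = Module.AEval'.of φ (φ (N' w)) := by
      rw [← Module.AEval'.X_smul_of, hN'def, LinearEquiv.apply_symm_apply]
    rw [h2] at h
    have h3 := congrArg (Module.AEval'.of φ).symm h
    rw [LinearEquiv.symm_apply_apply] at h3
    exact h3
  let ξ : Matrix n n K := Matrix.of fun a b => N' (Pi.single b 1) a
  -- `N'` and coefficientwise `D` obey the same Leibniz rule, so they differ by a `K`-linear map,
  -- with matrix `ξ`. Commutation of `N'` with `x` and `N' v = 0` then become the two claimed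
  -- identities.
  have hξ (w : n → K) : N' w = (fun a => D (w a)) + ξ.mulVec w := by
    conv_lhs => rw [← Finset.univ_sum_single w]
    rw [map_sum]
    funext a
    rw [Finset.sum_apply, Pi.add_apply]
    have (b : n) : N' (Pi.single b (w b)) a = (Pi.single b (D (w b)) : n → K) a + ξ a b * w b := by
      have h1 : (Pi.single b (w b) : n → K) = w b • Pi.single b 1 := by
        rw [← Pi.single_smul, smul_eq_mul, mul_one]
      rw [h1, hN'smul, ← Pi.single_smul, smul_eq_mul, mul_one]
      simp [ξ, mul_comm]
    rw [Finset.sum_congr rfl fun b _ => this b, Finset.sum_add_distrib, ← Finset.sum_apply,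
      Finset.univ_sum_single fun b => D (w b)]
    rfl
  refine ⟨ξ, ?_, ?_⟩
  · ext a b
    have h := congrFun (hN'x (Pi.single b 1)) a
    rw [hξ (x.mulVec _), Matrix.mulVec_single_one, Pi.add_apply] at h
    rw [Matrix.sub_apply, eq_sub_iff_add_eq]
    exact h
  · have h : N' v = 0 := by rw [hN'def, hNv, map_zero]
    rw [hξ] at h
    exact eq_neg_of_add_eq_zero_left h

/-- On the locus `[x, y] + i j = 0`, `x` nilpotent, the Liouville form `tr (y dx) + j di`
vanishes. -/
theorem liouville_eq_zero_of_moment_eq_zero {n : Type*} [Fintype n] [DecidableEq n]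
    (D : Derivation k K K) {x y : Matrix n n K} (hx : IsNilpotent x) (i j : n → K)
    (h : x * y - y * x + Matrix.vecMulVec i j = 0) :
    (∑ a, ∑ b, y b a * D (x a b)) + ∑ a, j a * D (i a) = 0 := by
  obtain ⟨ξ, h1, h2⟩ := exists_matrix_of_isNilpotent D hx i
  have e1 : ∑ a, ∑ b, y b a * D (x a b) = (y * x.map D).trace := by
    rw [Matrix.trace_mul_comm]
    simp only [Matrix.trace, Matrix.diag, Matrix.mul_apply, Matrix.map_apply]
    exact Finset.sum_congr rfl fun a _ => Finset.sum_congr rfl fun b _ => mul_comm _ _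
  have e2 : ∑ a, j a * D (i a) = -(Matrix.vecMulVec i j * ξ).trace := by
    have : ∑ a, j a * D (i a) = j ⬝ᵥ fun a => D (i a) := rfl
    rw [this, h2, dotProduct_neg, Matrix.trace_mul_comm, Matrix.mul_vecMulVec,
      Matrix.trace_vecMulVec, dotProduct_comm]
  have e3 : Matrix.vecMulVec i j = y * x - x * y := by
    rw [← sub_eq_zero, ← h]; abel
  -- By cyclicity `tr (y (xξ - ξx)) = tr ((yx - xy) ξ)`, and `yx - xy` is the rank-one matrix whose
  -- trace against `ξ` is the second term up to sign.
  rw [e1, e2, h1, e3, Matrix.mul_sub, Matrix.sub_mul, Matrix.trace_sub, Matrix.trace_sub,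
    ← Matrix.mul_assoc, Matrix.trace_mul_comm y (ξ * x), Matrix.mul_assoc ξ x y,
    Matrix.trace_mul_comm ξ]
  ring

end Connection

end

/-! ### Regular sequences of homogeneous polynomials -/

section

open MvPolynomial RingTheory.Sequence

section GradedRegular

variable {σ k : Type*} [Field k]

attribute [local instance] MvPolynomial.gradedAlgebra

theorem homogeneousComponent_mul_of_isHomogeneous {f : MvPolynomial σ k} {d : ℕ}
    (hf : f.IsHomogeneous d) (r : MvPolynomial σ k) (n : ℕ) :
    homogeneousComponent (d + n) (f * r) = f * homogeneousComponent n r := by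
  rw [← decomposition.decompose'_apply, ← decomposition.decompose'_apply]
  exact DirectSum.coe_decompose_mul_add_of_left_mem (homogeneousSubmodule σ k)
    ((mem_homogeneousSubmodule d f).2 hf)

theorem homogeneousComponent_mul_of_lt {f : MvPolynomial σ k} {d : ℕ}
    (hf : f.IsHomogeneous d) (r : MvPolynomial σ k) {n : ℕ} (hn : n < d) :
    homogeneousComponent n (f * r) = 0 := by
  rw [← decomposition.decompose'_apply]
  exact DirectSum.coe_decompose_mul_of_left_mem_of_not_le (homogeneousSubmodule σ k)
    ((mem_homogeneousSubmodule d f).2 hf) (not_le.2 hn)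

theorem isHomogeneous_ofList {l : List (MvPolynomial σ k)}
    (hl : ∀ f ∈ l, ∃ d, f.IsHomogeneous d) :
    (Ideal.ofList l).IsHomogeneous (homogeneousSubmodule σ k) :=
  Ideal.homogeneous_span _ _ fun f hf => hl f hf

/-- The ideal of the origin in affine space. -/
noncomputable def originIdeal (σ k : Type*) [Field k] : Ideal (MvPolynomial σ k) :=
  RingHom.ker (constantCoeff (R := k) (σ := σ))

instance originIdeal_isPrime : (originIdeal σ k).IsPrime := RingHom.ker_isPrime _

theorem mem_originIdeal {f : MvPolynomial σ k} : f ∈ originIdeal σ k ↔ constantCoeff f = 0 :=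
  RingHom.mem_ker

theorem IsHomogeneous.mem_originIdeal {f : MvPolynomial σ k} {d : ℕ} (hf : f.IsHomogeneous d)
    (hd : 0 < d) : f ∈ originIdeal σ k := by
  rw [_root_.mem_originIdeal, constantCoeff_eq]
  exact hf.coeff_eq_zero (by simpa using hd.ne)

/-- A weakly regular sequence in the local ring of the origin consisting of homogeneous polynomials
is weakly regular in the polynomial ring. -/
theorem isWeaklyRegular_of_localization {l : List (MvPolynomial σ k)}
    (hl : ∀ f ∈ l, ∃ d, f.IsHomogeneous d)
    (hreg : IsWeaklyRegular (Localization.AtPrime (originIdeal σ k))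
      (l.map (algebraMap (MvPolynomial σ k) (Localization.AtPrime (originIdeal σ k))))) :
    IsWeaklyRegular (MvPolynomial σ k) l := by
  set S := Localization.AtPrime (originIdeal σ k)
  induction l using List.reverseRecOn with
  | nil => exact .nil _ _
  | append_singleton l f ih =>
    rw [List.map_append, isWeaklyRegular_append_iff] at hreg
    rw [isWeaklyRegular_append_iff]
    have hl' : ∀ g ∈ l, ∃ d, g.IsHomogeneous d := fun g hg => hl g (by simp [hg])
    refine ⟨ih hl' hreg.1, ?_⟩
    obtain ⟨d, hf⟩ := hl f (by simp)
    have hreg2 := hreg.2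
    rw [List.map_singleton, isWeaklyRegular_singleton_iff,
      isSMulRegular_quotient_iff_mem_of_smul_mem] at hreg2
    rw [isWeaklyRegular_singleton_iff, isSMulRegular_quotient_iff_mem_of_smul_mem]
    intro r hr
    simp only [smul_eq_mul, Ideal.mul_top] at hr hreg2 ⊢
    have hI := isHomogeneous_ofList hl'
    -- Since the ideal and `f` are homogeneous, it suffices to treat each component of `r`.
    rw [mem_iff_homogeneousComponent_mem hI]
    intro n
    have h1 : f * homogeneousComponent n r ∈ Ideal.ofList l := by
      rw [← homogeneousComponent_mul_of_isHomogeneous hf]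
      exact homogeneousComponent_mem_of_mem hI hr _
    have h2 := hreg2 (algebraMap _ S (homogeneousComponent n r)) (by
      rw [← map_mul, ← Ideal.map_ofList]
      exact Ideal.mem_map_of_mem _ h1)
    rw [← Ideal.map_ofList, IsLocalization.algebraMap_mem_map_algebraMap_iff
      (originIdeal σ k).primeCompl] at h2
    obtain ⟨s, hs, hsr⟩ := h2
    -- The multiplier `s` does not vanish at the origin. The degree `n` part of its product with
    -- `homogeneousComponent n r` is that component times the nonzero constant term of `s`.
    have h3 := homogeneousComponent_mem_of_mem hI hsr (n + 0)
    rw [mul_comm, homogeneousComponent_mul_of_isHomogeneous (homogeneousComponent_isHomogeneous n r),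
      homogeneousComponent_zero] at h3
    have hs0 : coeff 0 s ≠ 0 := fun h => hs (mem_originIdeal.2 h)
    have h4 := Ideal.mul_mem_left _ (C (coeff 0 s)⁻¹) h3
    rwa [mul_comm (homogeneousComponent n r), ← mul_assoc, ← C_mul, inv_mul_cancel₀ hs0, C_1,
      one_mul] at h4

/-- Membership in an ideal generated by variables is tested monomial by monomial, and multiplication
by a further variable leaves the exponents of the others unchanged. The variables are the reference
system of parameters at the origin. -/
theorem isWeaklyRegular_X (l : List σ) (hl : l.Nodup) :
    IsWeaklyRegular (MvPolynomial σ k) (l.map (X : σ → MvPolynomial σ k)) := by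
  induction l using List.reverseRecOn with
  | nil => exact .nil _ _
  | append_singleton l a ih =>
    rw [List.nodup_append] at hl
    rw [List.map_append, isWeaklyRegular_append_iff]
    refine ⟨ih hl.1, ?_⟩
    rw [List.map_singleton, isWeaklyRegular_singleton_iff,
      isSMulRegular_quotient_iff_mem_of_smul_mem]
    intro r hr
    simp only [smul_eq_mul, Ideal.mul_top] at hr ⊢
    have hspan : Ideal.ofList (l.map (X : σ → MvPolynomial σ k)) = Ideal.span (X '' {i | i ∈ l}) := by
      rw [Ideal.ofList]
      congr 1
      ext
      simp
    rw [hspan, mem_ideal_span_X_image] at hr ⊢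
    intro m hm
    obtain ⟨i, hi, him⟩ := hr (Finsupp.single a 1 + m) (by
      rw [mem_support_iff, coeff_X_mul]
      exact mem_support_iff.1 hm)
    refine ⟨i, hi, fun h => him ?_⟩
    have : i ≠ a := fun e => hl.2.2 i hi a (by simp) e
    simp [h, this.symm]

theorem originIdeal_le_iff [Finite σ] {p : Ideal (MvPolynomial σ k)} :
    originIdeal σ k ≤ p ↔ ∀ i, X i ∈ p := by
  refine ⟨fun h i => h (mem_originIdeal.2 (constantCoeff_X k i)), fun h f hf => ?_⟩
  have : f ∈ Ideal.span (X '' (Set.univ : Set σ)) := by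
    rw [mem_ideal_span_X_image]
    intro m hm
    by_contra! h0
    have hm0 : m = 0 := Finsupp.ext fun i => h0 i trivial
    rw [mem_support_iff, hm0] at hm
    exact hm (mem_originIdeal.1 hf)
  refine Ideal.span_le.2 ?_ this
  rintro _ ⟨i, -, rfl⟩
  exact h i

/-- Homogeneous polynomials `f₁, …, f_m` of positive degree in `N` variables form a weakly regular
sequence if their common zero locus has dimension at most `N - m`. -/
theorem isWeaklyRegular_of_ringKrullDim_le [Fintype σ] {l : List (MvPolynomial σ k)}
    (hl : ∀ f ∈ l, ∃ d > 0, f.IsHomogeneous d) {e : ℕ} (he : l.length + e ≤ Fintype.card σ)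
    (hdim : ringKrullDim (MvPolynomial σ k ⧸ Ideal.ofList l) ≤ e) :
    IsWeaklyRegular (MvPolynomial σ k) l := by
  set P := originIdeal σ k with hP
  have hlP : Ideal.ofList l ≤ P := by
    rw [ofList_le_iff]
    intro f hf
    obtain ⟨d, hd, hfd⟩ := hl f hf
    exact IsHomogeneous.mem_originIdeal hfd hd
  set mk := Ideal.Quotient.mk (Ideal.ofList l) with hmk
  have hsurj : Function.Surjective mk := Ideal.Quotient.mk_surjective
  have : (P.map mk).IsPrime := Ideal.map_isPrime_of_surjective hsurj (by rwa [hmk, Ideal.mk_ker])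
  -- The origin has height at most `e` in the quotient ring, so it is minimal over at most `e`
  -- elements there. Their lifts `g` complete `l` to a list that cuts out the closed point of the
  -- local ring.
  obtain ⟨s, hs, hscard⟩ := Ideal.exists_finset_card_eq_height_of_isNoetherianRing (P.map mk)
  have hse : s.card ≤ e := by
    have h1 := (Ideal.height_le_ringKrullDim_of_ne_top (I := P.map mk) Ideal.IsPrime.ne_top').trans hdim
    rw [← hscard] at h1
    exact_mod_cast h1
  choose lift hlift using hsurj
  set g : List (MvPolynomial σ k) := s.toList.map lift with hg
  have hglen : g.length = s.card := by simp [hg]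
  have hgP : ∀ f ∈ g, f ∈ P := by
    intro f hf
    obtain ⟨x, hx, rfl⟩ := List.mem_map.1 hf
    have h1 : mk (lift x) ∈ P.map mk := by
      rw [hlift]
      exact hs.1.2 (Ideal.subset_span (Finset.mem_toList.1 hx))
    rw [hmk, ← Ideal.mem_comap, Ideal.comap_map_of_surjective _ Ideal.Quotient.mk_surjective,
      ← RingHom.ker_eq_comap_bot, Ideal.mk_ker, sup_eq_left.2 hlP] at h1
    exact h1
  have hmin : ∀ p : Ideal (MvPolynomial σ k), p.IsPrime → p ≤ P → (∀ f ∈ l, f ∈ p) →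
      (∀ f ∈ g, f ∈ p) → p = P := by
    intro p hp hpP hlp hgp
    have hlp' : Ideal.ofList l ≤ p := ofList_le_iff.2 hlp
    have hp' : (p.map mk).IsPrime :=
      Ideal.map_isPrime_of_surjective Ideal.Quotient.mk_surjective (Ideal.mk_ker.trans_le hlp')
    have h1 : P.map mk ≤ p.map mk := hs.2 ⟨hp', Ideal.span_le.2 fun x hx => by
      have := Ideal.mem_map_of_mem mk (hgp (lift x) (List.mem_map_of_mem (Finset.mem_toList.2 hx)))
      rwa [hlift] at this⟩ (Ideal.map_mono hpP)
    refine le_antisymm hpP ?_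
    have h2 := Ideal.comap_mono (f := mk) h1
    rwa [hmk, Ideal.comap_map_of_surjective _ Ideal.Quotient.mk_surjective,
      Ideal.comap_map_of_surjective _ Ideal.Quotient.mk_surjective,
      ← RingHom.ker_eq_comap_bot, Ideal.mk_ker, sup_eq_left.2 hlP, sup_eq_left.2 hlp'] at h2
  set S := Localization.AtPrime P with hS
  -- `isWeaklyRegular_of_parameters` compares lists of equal length, so zeros fill the gap. By
  -- Krull's height theorem there is none, but this need not be shown.
  let z : List (MvPolynomial σ k) := List.replicate (Fintype.card σ - l.length - s.card) 0
  let as : List (MvPolynomial σ k) := (Finset.univ : Finset σ).toList.map X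
  have : IsNoetherianRing S := IsLocalization.isNoetherianRing P.primeCompl S inferInstance
  have hmax (f : MvPolynomial σ k) (hf : f ∈ P) : algebraMap _ S f ∈ IsLocalRing.maximalIdeal S := by
    rw [← Localization.AtPrime.map_eq_maximalIdeal]
    exact Ideal.mem_map_of_mem _ hf
  have hcomap (p : Ideal S) (hp : p.IsPrime) (h : p.under (MvPolynomial σ k) = P) :
      p = IsLocalRing.maximalIdeal S := by
    rw [← Localization.AtPrime.map_eq_maximalIdeal, ← IsLocalization.map_under P.primeCompl S p, h]
  have hle (p : Ideal S) (hp : p.IsPrime) : p.under (MvPolynomial σ k) ≤ P := by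
    have h1 := IsLocalRing.le_maximalIdeal hp.ne_top
    have h2 := Ideal.comap_mono (f := algebraMap (MvPolynomial σ k) S) h1
    exact h2.trans_eq Localization.AtPrime.under_maximalIdeal
  have key := isWeaklyRegular_of_parameters (S := S) (Fintype.card σ) S
    (as.map (algebraMap _ S)) ((l ++ (g ++ z)).map (algebraMap _ S))
    (by simp [as]) (by simp [z, hglen]; omega) ?_ ?_ ?_ ?_ ?_
  · rw [List.map_append, isWeaklyRegular_append_iff] at key
    exact isWeaklyRegular_of_localization (fun f hf => (hl f hf).imp fun d hd => hd.2) key.1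
  · intro a ha
    obtain ⟨f, hf, rfl⟩ := List.mem_map.1 ha
    obtain ⟨i, -, rfl⟩ := List.mem_map.1 hf
    exact hmax _ (mem_originIdeal.2 (constantCoeff_X k i))
  · intro a ha
    obtain ⟨f, hf, rfl⟩ := List.mem_map.1 ha
    rw [List.mem_append, List.mem_append] at hf
    rcases hf with hf | hf | hf
    · exact hmax f (ofList_le_iff.1 hlP f hf)
    · exact hmax f (hgP f hf)
    · rw [List.eq_of_mem_replicate hf, map_zero]
      exact zero_mem _
  · exact IsWeaklyRegular.of_isLocalization S P.primeCompl (isWeaklyRegular_X _ (Finset.nodup_toList _))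
  · intro p hp _ hap
    refine hcomap p hp (le_antisymm (hle p hp) (originIdeal_le_iff.2 fun i => ?_))
    exact hap _ (List.mem_map_of_mem (List.mem_map_of_mem (Finset.mem_toList.2 (Finset.mem_univ i))))
  · intro p hp _ hbp
    refine hcomap p hp (hmin _ (hp.comap _) (hle p hp) (fun f hf => ?_) fun f hf => ?_)
    · exact hbp _ (List.mem_map_of_mem (by simp [hf]))
    · exact hbp _ (List.mem_map_of_mem (by simp [hf]))

end GradedRegular

end

/-! ### Freeness over a homogeneous regular sequence -/

section

open MvPolynomial RingTheory.Sequence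

section Freeness

open scoped Pointwise

variable {σ k : Type*} [Field k]

theorem exists_eq_X_zero_mul_add_rename {m : ℕ} (p : MvPolynomial (Fin (m + 1)) k) :
    ∃ (q : MvPolynomial (Fin (m + 1)) k) (r : MvPolynomial (Fin m) k),
      p = X 0 * q + rename Fin.succ r := by
  induction p using MvPolynomial.induction_on with
  | C a => exact ⟨0, C a, by simp⟩
  | add p₁ p₂ h₁ h₂ =>
    obtain ⟨q₁, r₁, h₁⟩ := h₁
    obtain ⟨q₂, r₂, h₂⟩ := h₂
    exact ⟨q₁ + q₂, r₁ + r₂, by rw [map_add]; linear_combination h₁ + h₂⟩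
  | mul_X p i h =>
    obtain ⟨q, r, h⟩ := h
    refine Fin.cases ⟨p, 0, by rw [map_zero]; ring⟩ (fun j => ⟨q * X j.succ, r * X j, ?_⟩) i
    rw [map_mul, rename_X]
    linear_combination X j.succ * h

theorem eq_zero_of_forall_X_pow_dvd {τ : Type*} {p : MvPolynomial τ k} (i : τ)
    (h : ∀ n, X i ^ n ∣ p) : p = 0 := by
  by_contra hp
  obtain ⟨q, hq⟩ := h (p.totalDegree + 1)
  have hq0 : q ≠ 0 := by rintro rfl; exact hp (by rw [hq, mul_zero])
  have h1 := totalDegree_mul_of_isDomain (pow_ne_zero (p.totalDegree + 1) (X_ne_zero (R := k) i)) hq0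
  rw [← hq, totalDegree_X_pow] at h1
  omega

/-- A family whose image modulo a weakly regular sequence `f` is linearly independent over `k` is
linearly independent over the polynomial ring in the `f`. -/
theorem eq_zero_of_sum_aeval_smul_eq_zero {R : Type*} [CommRing R] [Algebra k R] {ι : Type*}
    (m : ℕ) : ∀ (M : Type*) [AddCommGroup M] [Module R M] (f : Fin m → R) (b : ι → M),
    IsWeaklyRegular M (List.ofFn f) →
    (∀ (s : Finset ι) (c : ι → k), ∑ i ∈ s, algebraMap k R (c i) • b i ∈
      (Ideal.ofList (List.ofFn f) • ⊤ : Submodule R M) → ∀ i ∈ s, c i = 0) →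
    ∀ (s : Finset ι) (P : ι → MvPolynomial (Fin m) k), ∑ i ∈ s, aeval f (P i) • b i = 0 →
      ∀ i ∈ s, P i = 0 := by
  induction m with
  | zero =>
    intro M _ _ f b _ hb s P hP i hi
    have hC (i : ι) : P i = C (constantCoeff (P i)) := eq_C_of_isEmpty (P i)
    rw [hC i, hb s (fun i => constantCoeff (P i)) ?_ i hi, C_0]
    convert zero_mem (Ideal.ofList (List.ofFn f) • ⊤ : Submodule R M)
    rw [← hP]
    refine Finset.sum_congr rfl fun i _ => ?_
    conv_rhs => rw [hC i, aeval_C]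
  | succ m ih =>
    intro M _ _ f b hreg hb s
    rw [List.ofFn_succ, isWeaklyRegular_cons_iff] at hreg
    have haeval (q : MvPolynomial (Fin (m + 1)) k) (r : MvPolynomial (Fin m) k) :
        aeval f (X 0 * q + rename Fin.succ r) = f 0 * aeval f q + aeval (fun i => f i.succ) r := by
      rw [map_add, map_mul, aeval_X, aeval_rename]
      rfl
    have hmk0 (x : M) : (Submodule.Quotient.mk (f 0 • x) : QuotSMulTop (f 0) M) = 0 := by
      rw [Submodule.Quotient.mk_eq_zero]
      exact Submodule.smul_mem_pointwise_smul _ _ _ trivial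
    -- Modulo `f 0` the relation sees only the parts of the `P i` free of `X 0`, which vanish by the
    -- induction hypothesis. Hence `X 0` divides every `P i`, and the nonzerodivisor `f 0` can be
    -- cancelled.
    have step (P : ι → MvPolynomial (Fin (m + 1)) k) (hP : ∑ i ∈ s, aeval f (P i) • b i = 0) :
        ∃ Q : ι → MvPolynomial (Fin (m + 1)) k, (∀ i ∈ s, P i = X 0 * Q i) ∧
          ∑ i ∈ s, aeval f (Q i) • b i = 0 := by
      choose Q r hQr using fun i => exists_eq_X_zero_mul_add_rename (P i)
      have hsum : ∑ i ∈ s, aeval f (P i) • b i =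
          f 0 • ∑ i ∈ s, aeval f (Q i) • b i + ∑ i ∈ s, aeval (fun i => f i.succ) (r i) • b i := by
        rw [Finset.smul_sum, ← Finset.sum_add_distrib]
        refine Finset.sum_congr rfl fun i _ => ?_
        rw [hQr i, haeval, add_smul, mul_smul]
      have hr : ∀ i ∈ s, r i = 0 := by
        refine ih (QuotSMulTop (f 0) M) (fun i => f i.succ) (fun i => Submodule.Quotient.mk (b i))
          hreg.2 (fun t c hc => hb t c ?_) s r ?_
        · have hcomap : (Ideal.ofList (List.ofFn fun i => f i.succ) • ⊤ :
              Submodule R (QuotSMulTop (f 0) M)) =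
              (Ideal.ofList (List.ofFn fun i => f i.succ) • ⊤ : Submodule R M).map
                (Submodule.mkQ _) := by
            rw [Submodule.map_smul'', Submodule.map_top, Submodule.range_mkQ]
          have h1 : (∑ i ∈ t, algebraMap k R (c i) • (Submodule.Quotient.mk (b i) :
              QuotSMulTop (f 0) M)) =
              Submodule.mkQ (f 0 • ⊤ : Submodule R M) (∑ i ∈ t, algebraMap k R (c i) • b i) := by
            rw [map_sum]
            rfl
          rw [h1, hcomap] at hc
          obtain ⟨y, hy, hyc⟩ := hc
          have h2 := (Submodule.Quotient.eq _).1 hyc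
          have h3 : ∑ i ∈ t, algebraMap k R (c i) • b i =
              y - (y - ∑ i ∈ t, algebraMap k R (c i) • b i) := by abel
          rw [h3, List.ofFn_succ]
          refine sub_mem ?_ ?_
          · exact Submodule.smul_mono_left (by rw [Ideal.ofList_cons]; exact le_sup_right) hy
          · refine Submodule.smul_mono_left (I := Ideal.span {f 0})
              (by rw [Ideal.ofList_cons]; exact le_sup_left) ?_
            rwa [Submodule.ideal_span_singleton_smul]
        · have h1 := congrArg (Submodule.mkQ (f 0 • ⊤ : Submodule R M)) (hsum.symm.trans hP)
          rw [map_add, map_zero, map_sum] at h1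
          have h2 : Submodule.mkQ (f 0 • ⊤ : Submodule R M)
              (f 0 • ∑ i ∈ s, aeval f (Q i) • b i) = 0 := hmk0 _
          rw [h2, zero_add] at h1
          exact h1
      refine ⟨Q, fun i hi => by rw [hQr i, hr i hi, map_zero, add_zero], ?_⟩
      have h0 : ∑ i ∈ s, aeval (fun i => f i.succ) (r i) • b i = 0 :=
        Finset.sum_eq_zero fun i hi => by rw [hr i hi, map_zero, zero_smul]
      rw [h0, add_zero, hP] at hsum
      exact hreg.1 (hsum.symm.trans (smul_zero _).symm)
    -- Descent: the quotients satisfy the same relation, so every power of `X 0` divides the `P i`.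
    have hdvd (n : ℕ) : ∀ P : ι → MvPolynomial (Fin (m + 1)) k,
        ∑ i ∈ s, aeval f (P i) • b i = 0 → ∀ i ∈ s, X 0 ^ n ∣ P i := by
      induction n with
      | zero => intro P _ i _; simp
      | succ n ihn =>
        intro P hP i hi
        obtain ⟨Q, hPQ, hQ⟩ := step P hP
        rw [hPQ i hi, pow_succ']
        exact mul_dvd_mul_left _ (ihn Q hQ i hi)
    exact fun P hP i hi => eq_zero_of_forall_X_pow_dvd 0 fun n => hdvd n P hP i hi

theorem homogeneousComponent_mem_span_monomial {κ : Type*} (a : κ → σ →₀ ℕ)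
    {w : MvPolynomial σ k}
    (hw : w ∈ Submodule.span k (Set.range fun i => monomial (a i) (1 : k))) (n : ℕ) :
    homogeneousComponent n w ∈ Submodule.span k (Set.range fun i => monomial (a i) (1 : k)) := by
  induction hw using Submodule.span_induction with
  | mem x hx =>
    obtain ⟨i, rfl⟩ := hx
    have hh := isHomogeneous_monomial (σ := σ) (1 : k) (rfl : (a i).degree = (a i).degree)
    rw [homogeneousComponent_of_mem ((mem_homogeneousSubmodule _ _).2 hh)]
    split_ifs
    · exact Submodule.subset_span ⟨i, rfl⟩
    · exact zero_mem _
  | zero => rw [map_zero]; exact zero_mem _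
  | add x y _ _ hx hy => rw [map_add]; exact add_mem hx hy
  | smul c x _ hx => rw [map_smul]; exact Submodule.smul_mem _ _ hx

/-- The polynomial ring is free over the subring generated by a weakly regular sequence of
homogeneous polynomials of positive degree, which is itself a polynomial ring. -/
theorem flat_and_injective_of_isWeaklyRegular {m : ℕ} (f : Fin m → MvPolynomial σ k) (d : Fin m → ℕ)
    (hd : ∀ i, 0 < d i) (hf : ∀ i, (f i).IsHomogeneous (d i))
    (hreg : IsWeaklyRegular (MvPolynomial σ k) (List.ofFn f)) :
    (aeval f : MvPolynomial (Fin m) k →ₐ[k] MvPolynomial σ k).toRingHom.Flat ∧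
      Function.Injective (aeval f : MvPolynomial (Fin m) k →ₐ[k] MvPolynomial σ k) := by
  set I := Ideal.ofList (List.ofFn f) with hI
  have hIspan : I = Ideal.span (Set.range f) := by
    rw [hI, Ideal.ofList]
    congr 1
    ext
    simp [List.mem_ofFn]
  -- A basis of the quotient by `I` made of monomials: its span is stable under homogeneous
  -- components, as the degree induction below requires.
  obtain ⟨κ, a, -, hspan, hli⟩ := exists_linearIndependent' k
    fun e : σ →₀ ℕ => Ideal.Quotient.mk I (monomial e (1 : k))
  let b : κ → MvPolynomial σ k := fun i => monomial (a i) 1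
  have hspanb (r : MvPolynomial σ k) : ∃ w ∈ Submodule.span k (Set.range b), r - w ∈ I := by
    have h1 : Ideal.Quotient.mkₐ k I r ∈
        Submodule.span k (Set.range fun i => Ideal.Quotient.mk I (b i)) := by
      have : (Set.range fun i => Ideal.Quotient.mk I (b i)) =
        Set.range ((fun e : σ →₀ ℕ => Ideal.Quotient.mk I (monomial e (1 : k))) ∘ a) := rfl
      rw [this, hspan]
      have hr : r ∈ Submodule.span k (Set.range fun e : σ →₀ ℕ => monomial e (1 : k)) := by
        have := (basisMonomials σ k).span_eq
        rw [coe_basisMonomials] at this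
        rw [this]
        trivial
      have h2 := Submodule.mem_map_of_mem (f := (Ideal.Quotient.mkₐ k I).toLinearMap) hr
      rw [Submodule.map_span, ← Set.range_comp] at h2
      exact h2
    have h3 : (Set.range fun i => Ideal.Quotient.mk I (b i)) =
        (Ideal.Quotient.mkₐ k I).toLinearMap '' Set.range b := by
      rw [← Set.range_comp]
      rfl
    rw [h3, ← Submodule.map_span] at h1
    obtain ⟨w, hw, hwr⟩ := h1
    refine ⟨w, hw, ?_⟩
    rw [← Ideal.Quotient.eq]
    exact hwr.symm
  have hind (s : Finset κ) (P : κ → MvPolynomial (Fin m) k)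
      (hP : ∑ i ∈ s, aeval f (P i) * b i = 0) : ∀ i ∈ s, P i = 0 := by
    refine eq_zero_of_sum_aeval_smul_eq_zero m (MvPolynomial σ k) f b hreg (fun s c hc => ?_) s P hP
    rw [linearIndependent_iff'] at hli
    refine hli s c ?_
    rw [smul_eq_mul, Ideal.mul_top] at hc
    have h1 := Ideal.Quotient.eq_zero_iff_mem.2 hc
    rw [map_sum] at h1
    rw [← h1]
    refine Finset.sum_congr rfl fun i _ => ?_
    rw [smul_eq_mul, ← Algebra.smul_def]
    exact (map_smul (Ideal.Quotient.mkₐ k I) (c i) (b i)).symm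
  let _ : Algebra (MvPolynomial (Fin m) k) (MvPolynomial σ k) :=
    (aeval f : MvPolynomial (Fin m) k →ₐ[k] MvPolynomial σ k).toRingHom.toAlgebra
  have hsmul (P : MvPolynomial (Fin m) k) (r : MvPolynomial σ k) : P • r = aeval f P * r := rfl
  have : IsScalarTower k (MvPolynomial (Fin m) k) (MvPolynomial σ k) :=
    .of_algebraMap_eq fun c => by
      change _ = aeval f (C c)
      rw [aeval_C]
  have hliA : LinearIndependent (MvPolynomial (Fin m) k) b :=
    linearIndependent_iff'.2 fun s P hP => hind s P hP
  -- Graded Nakayama: up to the span of the monomials, the degree `n` part is a combination of the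
  -- `f i` with coefficients of degree `n - d i`, which is less than `n` because `d i` is positive.
  have hhom (n : ℕ) : ∀ r : MvPolynomial σ k,
      homogeneousComponent n r ∈ Submodule.span (MvPolynomial (Fin m) k) (Set.range b) := by
    induction n using Nat.strong_induction_on with
    | _ n ih =>
      intro r
      obtain ⟨w, hw, hrw⟩ := hspanb r
      rw [hIspan, Ideal.mem_span_range_iff_exists_fun] at hrw
      obtain ⟨g, hg⟩ := hrw
      have h1 : homogeneousComponent n r = homogeneousComponent n w +
          ∑ i, homogeneousComponent n (f i * g i) := by
        rw [← map_sum, ← map_add]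
        congr 1
        rw [← sub_eq_iff_eq_add', ← hg]
        exact Finset.sum_congr rfl fun i _ => mul_comm _ _
      rw [h1]
      refine add_mem ?_ (sum_mem fun i _ => ?_)
      · exact Submodule.span_le_restrictScalars k _ _
          (homogeneousComponent_mem_span_monomial a hw n)
      · rcases lt_or_ge n (d i) with hlt | hle
        · rw [homogeneousComponent_mul_of_lt (hf i) _ hlt]
          exact zero_mem _
        · obtain ⟨e, rfl⟩ := Nat.exists_eq_add_of_le hle
          have h2 := Submodule.smul_mem _ (X i : MvPolynomial (Fin m) k)
            (ih e (by have := hd i; omega) (g i))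
          rwa [hsmul, aeval_X, ← homogeneousComponent_mul_of_isHomogeneous (hf i)] at h2
  have htop : ⊤ ≤ Submodule.span (MvPolynomial (Fin m) k) (Set.range b) := by
    intro r _
    rw [← sum_homogeneousComponent r]
    exact sum_mem fun n _ => hhom n r
  have hfree : Module.Free (MvPolynomial (Fin m) k) (MvPolynomial σ k) :=
    .of_basis (Module.Basis.mk hliA htop)
  refine ⟨(inferInstance : Module.Flat (MvPolynomial (Fin m) k) (MvPolynomial σ k)), ?_⟩
  exact FaithfulSMul.algebraMap_injective (MvPolynomial (Fin m) k) (MvPolynomial σ k)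

end Freeness

end

/-! ### Flatness from the vanishing of the Liouville form -/

section

open MvPolynomial RingTheory.Sequence

/-- A chain of primes lives in the quotient by its smallest member, so bounding the dimension of
domains suffices. -/
theorem ringKrullDim_le_of_forall_quotient {B : Type*} [CommRing B] {e : ℕ}
    (h : ∀ P : Ideal B, P.IsPrime → ringKrullDim (B ⧸ P) ≤ e) : ringKrullDim B ≤ e := by
  refine iSup_le fun q => ?_
  have h1 := h q.head.asIdeal q.head.isPrime
  rw [ringKrullDim_quotient] at h1
  let q' : LTSeries (PrimeSpectrum.zeroLocus (R := B) (q.head.asIdeal : Set B)) :=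
    { length := q.length
      toFun := fun i => ⟨q i, q.head_le i⟩
      step := fun i => q.step i }
  exact (Order.LTSeries.length_le_krullDim q').trans h1

theorem Derivation.eq_zero_of_forall_aeval_X {σ K A : Type*} [Field K] [CommRing A] [IsDomain A]
    [Algebra A K] [IsFractionRing A K] {k : Type*} [Field k] [Algebra k K]
    (φ : MvPolynomial σ k →+* A) (hφ : Function.Surjective φ) (z : σ → K)
    (hz : ∀ f, algebraMap A K (φ f) = aeval z f) (E : Derivation k K K) (hE : ∀ i, E (z i) = 0) :
    E = 0 := by
  have h1 (f : MvPolynomial σ k) : E (aeval z f) = 0 := by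
    induction f using MvPolynomial.induction_on with
    | C a => rw [aeval_C, Derivation.map_algebraMap]
    | add p q hp hq => rw [map_add, map_add, hp, hq, add_zero]
    | mul_X p i hp => rw [map_mul, Derivation.leibniz, hp, aeval_X, hE, smul_zero, smul_zero, add_zero]
  ext x
  obtain ⟨a, b, -, rfl⟩ := IsFractionRing.div_surjective A x
  obtain ⟨f, rfl⟩ := hφ a
  obtain ⟨g, rfl⟩ := hφ b
  rw [Derivation.leibniz_div, hz, hz, h1, h1, smul_zero, smul_zero, sub_zero, smul_zero]
  rfl

/-- If the Liouville form `∑ p dq` vanishes on the locus cut out by the homogeneous polynomials `F`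
and the linear forms `l`, and the number of all these and of the `q` is at most the number of
variables, then the `F` define a flat and dominant morphism to affine space. -/
theorem flat_and_injective_of_liouville_eq_zero {k : Type} [Field k] [CharZero k]
    {σ ι τ κ : Type} [Fintype σ] [Fintype ι] [Fintype τ] [Fintype κ]
    (F : ι → MvPolynomial σ k) (d : ι → ℕ) (hd : ∀ i, 0 < d i) (hF : ∀ i, (F i).IsHomogeneous (d i))
    (l : τ → MvPolynomial σ k) (hl : ∀ i, (l i).IsHomogeneous 1) (p q : κ → MvPolynomial σ k)
    (hgen : ∀ s, X s ∈ Submodule.span k (Set.range p ∪ Set.range q ∪ Set.range l))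
    (hcard : Fintype.card ι + Fintype.card τ + Fintype.card κ ≤ Fintype.card σ)
    (hpt : ∀ (K : Type) [Field K] [Algebra k K] (z : σ → K), (∀ i, aeval z (F i) = 0) →
      (∀ i, aeval z (l i) = 0) → ∀ D : Derivation k K K,
      ∑ a, aeval z (p a) * D (aeval z (q a)) = 0) :
    (aeval F : MvPolynomial ι k →ₐ[k] MvPolynomial σ k).toRingHom.Flat ∧
      Function.Injective (aeval F : MvPolynomial ι k →ₐ[k] MvPolynomial σ k) := by
  let e := Fintype.equivFin ι
  set lF : List (MvPolynomial σ k) := List.ofFn fun i => F (e.symm i) with hlF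
  set ll : List (MvPolynomial σ k) := (Finset.univ : Finset τ).toList.map l with hll
  have hmemF (i : ι) : F i ∈ lF := by
    rw [hlF, List.mem_ofFn]
    exact ⟨e i, by simp⟩
  have hmeml (i : τ) : l i ∈ ll := List.mem_map_of_mem (by simp)
  -- Each integral quotient is treated through its fraction field `K`. The `l` vanish there, so a
  -- derivation killing all `p` and `q` kills every coordinate, and the isotropy bound applies.
  have hdim : ringKrullDim (MvPolynomial σ k ⧸ Ideal.ofList (lF ++ ll)) ≤ Fintype.card κ := by
    refine ringKrullDim_le_of_forall_quotient fun P hP => ?_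
    let A := (MvPolynomial σ k ⧸ Ideal.ofList (lF ++ ll)) ⧸ P
    let K := FractionRing A
    let φ : MvPolynomial σ k →ₐ[k] A :=
      (Ideal.Quotient.mkₐ k P).comp (Ideal.Quotient.mkₐ k (Ideal.ofList (lF ++ ll)))
    have hφ : Function.Surjective φ :=
      (Ideal.Quotient.mkₐ_surjective k P).comp (Ideal.Quotient.mkₐ_surjective k _)
    have : Algebra.FiniteType k A := .of_surjective φ hφ
    let z : σ → K := fun i => algebraMap A K (φ (X i))
    have hz (f : MvPolynomial σ k) : algebraMap A K (φ f) = aeval z f := by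
      have : (IsScalarTower.toAlgHom k A K).comp φ = aeval z := by
        ext i
        simp [z]
      exact DFunLike.congr_fun this f
    have hzero (f : MvPolynomial σ k) (hf : f ∈ lF ++ ll) : aeval z f = 0 := by
      have : φ f = 0 := by
        have : Ideal.Quotient.mk (Ideal.ofList (lF ++ ll)) f = 0 :=
          Ideal.Quotient.eq_zero_iff_mem.2 (Ideal.subset_span hf)
        change Ideal.Quotient.mk P (Ideal.Quotient.mk _ f) = 0
        rw [this, map_zero]
      rw [← hz, this, map_zero]
    obtain ⟨s, hs, t, D, hD⟩ := exists_derivations_of_finiteType (k := k) (A := A) (K := K)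
    refine hs.trans (Nat.cast_le.2 ?_)
    refine card_le_of_liouville_eq_zero hD (fun a => aeval z (p a)) (fun a => aeval z (q a))
      (hpt K z (fun i => hzero _ (List.mem_append_left _ (hmemF i)))
        fun i => hzero _ (List.mem_append_right _ (hmeml i))) fun E hEp hEq => ?_
    refine Derivation.eq_zero_of_forall_aeval_X φ.toRingHom hφ z hz E fun i => ?_
    have h1 : Submodule.span k (Set.range p ∪ Set.range q ∪ Set.range l) ≤
        LinearMap.ker (E.toLinearMap ∘ₗ (aeval z).toLinearMap) := by
      rw [Submodule.span_le]
      rintro _ ((⟨a, rfl⟩ | ⟨a, rfl⟩) | ⟨a, rfl⟩)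
      · exact hEp a
      · exact hEq a
      · change E (aeval z (l a)) = 0
        rw [hzero _ (List.mem_append_right _ (hmeml a)), map_zero]
    have h2 : E (aeval z (X i)) = 0 := h1 (hgen i)
    rwa [aeval_X] at h2
  have hreg : IsWeaklyRegular (MvPolynomial σ k) (lF ++ ll) := by
    refine isWeaklyRegular_of_ringKrullDim_le (fun f hf => ?_) (e := Fintype.card κ) ?_ hdim
    · rcases List.mem_append.1 hf with hf | hf
      · rw [hlF, List.mem_ofFn] at hf
        obtain ⟨i, rfl⟩ := hf
        exact ⟨_, hd _, hF _⟩
      · obtain ⟨i, -, rfl⟩ := List.mem_map.1 hf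
        exact ⟨1, one_pos, hl i⟩
    · simpa [hlF, hll] using hcard
  -- The linear forms stand last, so the `F` alone form a regular prefix.
  rw [isWeaklyRegular_append_iff] at hreg
  obtain ⟨h1, h2⟩ := flat_and_injective_of_isWeaklyRegular (fun i => F (e.symm i))
    (fun i => d (e.symm i)) (fun i => hd _) (fun i => hF _) hreg.1
  have hcomp : (aeval F : MvPolynomial ι k →ₐ[k] MvPolynomial σ k) =
      (aeval fun i => F (e.symm i)).comp (renameEquiv k e).toAlgHom := by
    ext i
    simp
  rw [hcomp]
  refine ⟨?_, h2.comp (renameEquiv k e).injective⟩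
  exact RingHom.Flat.comp (RingHom.Flat.of_bijective (renameEquiv k e).bijective) h1

end

/-! ### Coordinate rings of affine space and of the symmetric product -/

section

open MvPolynomial

section PolynomialFunctions

variable {σ X : Type*} [AddCommGroup X] [Module ℂ X] (b : Module.Basis σ ℂ X)

/-- The polynomial function attached to a polynomial in the coordinates of a basis. -/
noncomputable def evalFun : MvPolynomial σ ℂ →ₐ[ℂ] (X → ℂ) := aeval fun s x => b.repr x s

theorem evalFun_apply (p : MvPolynomial σ ℂ) (x : X) : evalFun b p x = eval (b.repr x) p := by
  have h : (Pi.evalAlgHom ℂ (fun _ : X => ℂ) x).comp (evalFun b) = aeval (b.repr x) := by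
    ext s
    simp [evalFun]
  exact (DFunLike.congr_fun h p).trans (RingHom.congr_fun (coe_aeval_eq_eval _) p)

variable [Fintype σ]

/-- The linear form `φ` on `X` as a polynomial in the coordinates of a basis. -/
noncomputable def linForm : Module.Dual ℂ X →ₗ[ℂ] MvPolynomial σ ℂ where
  toFun φ := ∑ s, C (φ (b s)) * MvPolynomial.X s
  map_add' φ ψ := by simp [add_mul, Finset.sum_add_distrib]
  map_smul' c φ := by simp [Finset.smul_sum, smul_eq_C_mul, mul_assoc]

theorem linForm_apply (φ : Module.Dual ℂ X) :
    linForm b φ = ∑ s, C (φ (b s)) * MvPolynomial.X s := rfl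

theorem isHomogeneous_linForm (φ : Module.Dual ℂ X) : (linForm b φ).IsHomogeneous 1 :=
  IsHomogeneous.sum _ _ _ fun s _ => isHomogeneous_C_mul_X _ s

theorem evalFun_linForm (φ : Module.Dual ℂ X) : evalFun b (linForm b φ) = φ := by
  funext x
  rw [evalFun_apply, linForm_apply, map_sum]
  conv_rhs => rw [← b.sum_repr x, map_sum]
  refine Finset.sum_congr rfl fun s _ => ?_
  rw [map_mul, eval_C, eval_X, map_smul, smul_eq_mul, mul_comm]

theorem linForm_coord (s : σ) : linForm b (b.coord s) = MvPolynomial.X s := by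
  classical
  rw [linForm_apply, Finset.sum_eq_single s]
  · simp
  · intro t _ hts
    simp [hts]
  · simp

theorem evalFun_injective : Function.Injective (evalFun b) := by
  intro p q h
  refine MvPolynomial.funext fun z => ?_
  have := congrFun h (b.equivFun.symm z)
  rw [evalFun_apply, evalFun_apply] at this
  have hz : ⇑(b.repr (b.equivFun.symm z)) = z := b.equivFun.apply_symm_apply z
  rwa [hz] at this

theorem range_evalFun : (evalFun b).range = polyFun X := by
  refine le_antisymm ?_ ?_
  · rw [evalFun, ← Algebra.adjoin_range_eq_range_aeval]
    refine Algebra.adjoin_mono ?_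
    rintro _ ⟨s, rfl⟩
    exact ⟨b.coord s, rfl⟩
  · refine Algebra.adjoin_le ?_
    rintro _ ⟨φ, rfl⟩
    exact ⟨linForm b φ, evalFun_linForm b φ⟩

theorem polyFun_eq_adjoin {ι : Type*} (ψ : ι → Module.Dual ℂ X)
    (hψ : Submodule.span ℂ (Set.range ψ) = ⊤) :
    polyFun X = Algebra.adjoin ℂ (Set.range fun i => (ψ i : X → ℂ)) := by
  refine le_antisymm (Algebra.adjoin_le ?_) (Algebra.adjoin_mono ?_)
  · rintro _ ⟨φ, rfl⟩
    have hφ : φ ∈ Submodule.span ℂ (Set.range ψ) := hψ ▸ trivial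
    induction hφ using Submodule.span_induction with
    | mem x hx =>
      obtain ⟨i, rfl⟩ := hx
      exact Algebra.subset_adjoin ⟨i, rfl⟩
    | zero => exact zero_mem _
    | add x y _ _ hx hy => exact add_mem hx hy
    | smul c x _ hx => exact Subalgebra.smul_mem _ hx c
  · rintro _ ⟨i, rfl⟩
    exact ⟨ψ i, rfl⟩

/-- A family of linear forms without common zero spans the dual space. -/
theorem span_range_eq_top_of_forall_eq_zero [FiniteDimensional ℂ X] {ι : Type*}
    (ψ : ι → Module.Dual ℂ X) (h : ∀ x, (∀ i, ψ i x = 0) → x = 0) :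
    Submodule.span ℂ (Set.range ψ) = ⊤ := by
  have h0 : (Submodule.span ℂ (Set.range ψ)).dualCoannihilator = ⊥ := by
    rw [eq_bot_iff]
    intro x hx
    rw [Submodule.mem_dualCoannihilator] at hx
    exact h x fun i => hx _ (Submodule.subset_span ⟨i, rfl⟩)
  rw [← Subspace.dualCoannihilator_dualAnnihilator_eq (W := Submodule.span ℂ (Set.range ψ)), h0,
    Submodule.dualAnnihilator_bot]

end PolynomialFunctions

section SymmetricProduct

/-- The `d`-th coefficient of the monic polynomial with a given multiset of roots. -/
noncomputable def rootCoeff {n : ℕ} (d : ℕ) (s : Sym ℂ n) : ℂ :=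
  ((s : Multiset ℂ).map fun a => Polynomial.X - Polynomial.C a).prod.coeff d

theorem rootCoeff_eq_esymm {n d : ℕ} (hd : d ≤ n) (s : Sym ℂ n) :
    rootCoeff d s = (-1) ^ (n - d) * (s : Multiset ℂ).esymm (n - d) := by
  rw [rootCoeff, Multiset.prod_X_sub_C_coeff _ (by rwa [Sym.card_coe]), Sym.card_coe]

theorem symMk_surjective (n : ℕ) : Function.Surjective (symMk n) := by
  rintro ⟨s, hs⟩
  obtain ⟨l, rfl⟩ := Quot.exists_rep s
  have hl : l.length = n := hs
  subst hl
  refine ⟨fun i => l.get i, Subtype.ext ?_⟩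
  change Multiset.map l.get Finset.univ.val = (l : Multiset ℂ)
  rw [Fin.univ_val_map]
  simp

theorem esymm_symMk (n d : ℕ) (z : Fin n → ℂ) :
    (symMk n z : Multiset ℂ).esymm d = eval z (esymm (Fin n) ℂ d) := by
  rw [← coe_aeval_eq_eval, RingHom.coe_coe, aeval_esymm_eq_multiset_esymm]
  rfl

theorem evalFun_basisFun {n : ℕ} (p : MvPolynomial (Fin n) ℂ) (z : Fin n → ℂ) :
    evalFun (Pi.basisFun ℂ (Fin n)) p z = eval z p := by
  rw [evalFun_apply]
  rfl

/-- The fundamental theorem on symmetric polynomials: the coordinate ring of the symmetric product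
is generated by the coefficients of the monic polynomial with the given roots. -/
theorem symFun_eq_adjoin (n : ℕ) :
    symFun n = Algebra.adjoin ℂ (Set.range fun d : Fin n => rootCoeff (n := n) d) := by
  refine le_antisymm ?_ (Algebra.adjoin_le ?_)
  · intro f hf
    have hf' : f ∘ symMk n ∈ polyFun (Fin n → ℂ) := hf
    rw [← range_evalFun (Pi.basisFun ℂ (Fin n))] at hf'
    obtain ⟨P, hP⟩ := hf'
    have hPz (z : Fin n → ℂ) : eval z P = f (symMk n z) := by
      rw [← evalFun_basisFun]
      exact congrFun hP z
    have hsymm : P ∈ symmetricSubalgebra (Fin n) ℂ := by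
      rw [mem_symmetricSubalgebra]
      intro e
      refine MvPolynomial.funext fun z => ?_
      rw [eval_rename, hPz, hPz]
      congr 1
      refine Subtype.ext ?_
      change Multiset.map (z ∘ e) Finset.univ.val = Multiset.map z Finset.univ.val
      rw [← Multiset.map_map, ← Finset.map_univ_equiv e]
      simp
    obtain ⟨Q, hQ⟩ := (esymmAlgEquiv (Fin n) ℂ (Fintype.card_fin n)).surjective ⟨P, hsymm⟩
    have hQ' : aeval (fun i : Fin n => esymm (Fin n) ℂ (i + 1)) Q = P := by
      rw [← esymmAlgHom_apply]
      exact congrArg Subtype.val hQ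
    have hfQ : f = aeval (fun (i : Fin n) (s : Sym ℂ n) => (s : Multiset ℂ).esymm (i + 1)) Q := by
      funext s
      obtain ⟨z, rfl⟩ := symMk_surjective n s
      have h1 : (Pi.evalAlgHom ℂ (fun _ : Sym ℂ n => ℂ) (symMk n z)).comp
          (aeval fun (i : Fin n) (s : Sym ℂ n) => (s : Multiset ℂ).esymm (i + 1)) =
          (aeval z).comp (aeval fun i : Fin n => esymm (Fin n) ℂ (i + 1)) := by
        ext i
        simp only [AlgHom.comp_apply, aeval_X, Pi.evalAlgHom_apply, esymm_symMk]
        exact (RingHom.congr_fun (coe_aeval_eq_eval z) _).symm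
      have h2 := DFunLike.congr_fun h1 Q
      rw [AlgHom.comp_apply, AlgHom.comp_apply, hQ'] at h2
      rw [← hPz]
      exact (h2.trans (RingHom.congr_fun (coe_aeval_eq_eval z) P)).symm
    rw [hfQ]
    refine (Algebra.adjoin_le (S := Algebra.adjoin ℂ _) ?_)
      ((Algebra.adjoin_range_eq_range_aeval ℂ _).ge ⟨Q, rfl⟩)
    rintro _ ⟨i, rfl⟩
    have h3 : (fun s : Sym ℂ n => (s : Multiset ℂ).esymm (i + 1)) =
        (-1 : ℂ) ^ ((i : ℕ) + 1) • rootCoeff (n := n) ((⟨n - (i + 1), by omega⟩ : Fin n) : ℕ) := by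
      funext s
      have h4 : n - (n - ((i : ℕ) + 1)) = i + 1 := by omega
      rw [Pi.smul_apply, rootCoeff_eq_esymm (by simp), h4, smul_eq_mul, ← mul_assoc, ← mul_pow]
      simp
    change (fun s : Sym ℂ n => (s : Multiset ℂ).esymm (i + 1)) ∈
      Algebra.adjoin ℂ (Set.range fun d : Fin n => rootCoeff (n := n) d)
    rw [h3]
    have h5 : rootCoeff (n := n) ((⟨n - (i + 1), by omega⟩ : Fin n) : ℕ) ∈
        Algebra.adjoin ℂ (Set.range fun d : Fin n => rootCoeff (n := n) d) :=
      Algebra.subset_adjoin ⟨⟨n - (i + 1), by omega⟩, rfl⟩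
    exact Subalgebra.smul_mem _ h5 _
  · rintro _ ⟨d, rfl⟩
    change (rootCoeff (d : ℕ)) ∘ symMk n ∈ polyFun (Fin n → ℂ)
    rw [← range_evalFun (Pi.basisFun ℂ (Fin n))]
    refine ⟨C ((-1) ^ (n - (d : ℕ))) * esymm (Fin n) ℂ (n - d), funext fun z => ?_⟩
    change evalFun (Pi.basisFun ℂ (Fin n)) _ z = _
    rw [evalFun_basisFun, Function.comp_apply, rootCoeff_eq_esymm d.2.le,
      map_mul, eval_C, esymm_symMk]

/-- This is the reason for generating `symFun` by root coefficients: along the eigenvalue map they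
pull back to coefficients of the characteristic polynomial, which are polynomial in the matrix
entries. -/
theorem rootCoeff_eigenvalueMap {V : Type*} [AddCommGroup V] [Module ℂ V] [FiniteDimensional ℂ V]
    (B : Module.End ℂ V) (d : ℕ) : rootCoeff d (eigenvalueMap B) = B.charpoly.coeff d := by
  have h := (IsAlgClosed.splits B.charpoly).eq_prod_roots_of_monic B.charpoly_monic
  conv_rhs => rw [h]
  rfl

theorem prodFun_eq_adjoin {Y : Type*} [AddCommGroup Y] [Module ℂ Y] {ι : Type*} (n : ℕ)
    (ψ : ι → Module.Dual ℂ Y) (hψ : Submodule.span ℂ (Set.range ψ) = ⊤) :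
    prodFun (polyFun Y) (symFun n) = Algebra.adjoin ℂ (Set.range
      (Sum.elim (fun i (y : Y × Sym ℂ n) => ψ i y.1) fun (d : Fin n) y => rootCoeff d y.2)) := by
  rw [prodFun, polyFun_eq_adjoin ψ hψ, symFun_eq_adjoin, AlgHom.map_adjoin, AlgHom.map_adjoin,
    ← Algebra.adjoin_union, Set.Sum.elim_range, ← Set.range_comp, ← Set.range_comp]
  rfl

end SymmetricProduct

/-- A morphism from an affine space to a variety with generating functions `g` is flat if the
polynomials `g ∘ φ` are algebraically independent and the polynomial ring is flat over them. -/
theorem isFlatMorphism_of_flat_aeval {X Y : Type u} [AddCommGroup X] [Module ℂ X] {σ ι : Type*}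
    [Fintype σ] (b : Module.Basis σ ℂ X) (B : Subalgebra ℂ (Y → ℂ)) (φ : X → Y) (g : ι → Y → ℂ)
    (hB : B = Algebra.adjoin ℂ (Set.range g)) (F : ι → MvPolynomial σ ℂ)
    (hF : ∀ i, evalFun b (F i) = g i ∘ φ)
    (hflat : (aeval F : MvPolynomial ι ℂ →ₐ[ℂ] MvPolynomial σ ℂ).toRingHom.Flat)
    (hinj : Function.Injective (aeval F : MvPolynomial ι ℂ →ₐ[ℂ] MvPolynomial σ ℂ)) :
    IsFlatMorphism (polyFun X) B φ := by
  have hmor : IsMorphism (polyFun X) B φ := by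
    have : B ≤ (polyFun X).comap (pullbackFun φ) := by
      rw [hB]
      refine Algebra.adjoin_le ?_
      rintro _ ⟨i, rfl⟩
      change g i ∘ φ ∈ polyFun X
      rw [← hF i, ← range_evalFun b]
      exact ⟨F i, rfl⟩
    exact fun f hf => this hf
  refine ⟨hmor, ?_⟩
  rw [schemeMap, AlgebraicGeometry.Flat.SpecMap_iff]
  change (comorphism hmor).toRingHom.Flat
  let ε : MvPolynomial σ ℂ →ₐ[ℂ] polyFun X :=
    (evalFun b).codRestrict (polyFun X) fun p => by rw [← range_evalFun b]; exact ⟨p, rfl⟩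
  have hε : Function.Bijective ε := by
    refine ⟨fun p q h => evalFun_injective b (congrArg Subtype.val h), fun f => ?_⟩
    obtain ⟨p, hp⟩ := (range_evalFun b).ge f.2
    exact ⟨p, Subtype.ext hp⟩
  have hg (i : ι) : g i ∈ B := hB ▸ Algebra.subset_adjoin ⟨i, rfl⟩
  let π : MvPolynomial ι ℂ →ₐ[ℂ] B := aeval fun i => ⟨g i, hg i⟩
  have hcomp : (comorphism hmor).comp π = ε.comp (aeval F) := by
    ext i : 1
    refine Subtype.ext ?_
    simp only [AlgHom.comp_apply, π, aeval_X]
    exact (hF i).symm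
  -- A relation among the `g i` pulls back to a relation among the `F i`, which `hinj` excludes. So
  -- the target ring is a polynomial ring without a separate check.
  have hπ : Function.Bijective π := by
    refine ⟨fun p q h => ?_, fun f => ?_⟩
    · refine hinj (hε.1 ?_)
      have := congrArg (comorphism hmor) h
      rwa [← AlgHom.comp_apply, ← AlgHom.comp_apply, hcomp] at this
    · have hf : (f : Y → ℂ) ∈ Algebra.adjoin ℂ (Set.range g) := hB ▸ f.2
      rw [Algebra.adjoin_range_eq_range_aeval] at hf
      obtain ⟨p, hp⟩ := hf
      refine ⟨p, Subtype.ext ?_⟩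
      rw [← hp]
      have : B.val.comp π = aeval g := by
        ext i : 1
        simp [π]
      exact DFunLike.congr_fun this p
  let e := AlgEquiv.ofBijective π hπ
  have h1 : comorphism hmor = (ε.comp (aeval F)).comp e.symm.toAlgHom := by
    rw [← hcomp]
    ext f : 1
    have : π (e.symm f) = f := e.apply_symm_apply f
    simp [this]
  rw [h1]
  exact RingHom.Flat.comp (RingHom.Flat.of_bijective e.symm.bijective)
    (RingHom.Flat.comp hflat (RingHom.Flat.of_bijective hε))

end

/-! ### Generic matrices and the flatness criterion for matrix data -/

section

open MvPolynomial

section GenericMatrices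

variable {σ X : Type*} [Fintype σ] [AddCommGroup X] [Module ℂ X] (b : Module.Basis σ ℂ X)
variable {m n r : Type*}

/-- The matrix of linear forms attached to a linear map to a space of matrices. -/
noncomputable def genericMatrix (T : X →ₗ[ℂ] Matrix m n ℂ) : Matrix m n (MvPolynomial σ ℂ) :=
  Matrix.of fun a c => linForm b (Matrix.entryLinearMap ℂ ℂ a c ∘ₗ T)

theorem genericMatrix_apply (T : X →ₗ[ℂ] Matrix m n ℂ) (a : m) (c : n) :
    genericMatrix b T a c = linForm b (Matrix.entryLinearMap ℂ ℂ a c ∘ₗ T) := rfl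

theorem isHomogeneous_genericMatrix (T : X →ₗ[ℂ] Matrix m n ℂ) (a : m) (c : n) :
    (genericMatrix b T a c).IsHomogeneous 1 := isHomogeneous_linForm b _

theorem genericMatrix_map_eval (T : X →ₗ[ℂ] Matrix m n ℂ) (x : X) :
    (genericMatrix b T).map (eval (b.repr x)) = T x := by
  ext a c
  rw [Matrix.map_apply, genericMatrix_apply, ← evalFun_apply, evalFun_linForm]
  rfl

theorem isHomogeneous_mul_genericMatrix [Fintype n] (T : X →ₗ[ℂ] Matrix m n ℂ)
    (T' : X →ₗ[ℂ] Matrix n r ℂ) (a : m) (c : r) :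
    ((genericMatrix b T * genericMatrix b T') a c).IsHomogeneous 2 := by
  rw [Matrix.mul_apply]
  exact IsHomogeneous.sum _ _ _ fun s _ =>
    (isHomogeneous_genericMatrix b T a s).mul (isHomogeneous_genericMatrix b T' s c)

variable [Fintype n] [Fintype r]

/-- The moment map in coordinates. -/
noncomputable def genericMoment (Tx Ty : X →ₗ[ℂ] Matrix n n ℂ) (Ti : X →ₗ[ℂ] Matrix n r ℂ)
    (Tj : X →ₗ[ℂ] Matrix r n ℂ) : Matrix n n (MvPolynomial σ ℂ) :=
  genericMatrix b Tx * genericMatrix b Ty - genericMatrix b Ty * genericMatrix b Tx +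
    genericMatrix b Ti * genericMatrix b Tj

theorem genericMoment_map {S : Type*} [CommRing S] (f : MvPolynomial σ ℂ →+* S)
    (Tx Ty : X →ₗ[ℂ] Matrix n n ℂ) (Ti : X →ₗ[ℂ] Matrix n r ℂ) (Tj : X →ₗ[ℂ] Matrix r n ℂ) :
    (genericMoment b Tx Ty Ti Tj).map f =
      (genericMatrix b Tx).map f * (genericMatrix b Ty).map f -
        (genericMatrix b Ty).map f * (genericMatrix b Tx).map f +
        (genericMatrix b Ti).map f * (genericMatrix b Tj).map f := by
  rw [genericMoment, Matrix.map_add f (map_add f), Matrix.map_sub f (map_sub f), Matrix.map_mul,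
    Matrix.map_mul, Matrix.map_mul]

theorem evalFun_genericMoment (Tx Ty : X →ₗ[ℂ] Matrix n n ℂ) (Ti : X →ₗ[ℂ] Matrix n r ℂ)
    (Tj : X →ₗ[ℂ] Matrix r n ℂ) (a c : n) (x : X) :
    evalFun b (genericMoment b Tx Ty Ti Tj a c) x =
      (Tx x * Ty x - Ty x * Tx x + Ti x * Tj x) a c := by
  have h := genericMoment_map b (eval (b.repr x)) Tx Ty Ti Tj
  simp only [genericMatrix_map_eval] at h
  rw [evalFun_apply, ← h, Matrix.map_apply]

theorem isHomogeneous_genericMoment (Tx Ty : X →ₗ[ℂ] Matrix n n ℂ) (Ti : X →ₗ[ℂ] Matrix n r ℂ)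
    (Tj : X →ₗ[ℂ] Matrix r n ℂ) (a c : n) :
    (genericMoment b Tx Ty Ti Tj a c).IsHomogeneous 2 :=
  ((isHomogeneous_mul_genericMatrix b Tx Ty a c).sub
    (isHomogeneous_mul_genericMatrix b Ty Tx a c)).add (isHomogeneous_mul_genericMatrix b Ti Tj a c)

variable [DecidableEq n]

theorem evalFun_charpoly_coeff (T : X →ₗ[ℂ] Matrix n n ℂ) (d : ℕ) (x : X) :
    evalFun b ((genericMatrix b T).charpoly.coeff d) x = (T x).charpoly.coeff d := by
  rw [evalFun_apply, ← genericMatrix_map_eval b T x, Matrix.charpoly_map, Polynomial.coeff_map]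

/-- The coefficients of the universal characteristic polynomial are homogeneous in the entries, and
here linear forms are substituted for the entries. -/
theorem isHomogeneous_charpoly_coeff (T : X →ₗ[ℂ] Matrix n n ℂ) {d e : ℕ}
    (hde : d + e = Fintype.card n) :
    ((genericMatrix b T).charpoly.coeff d).IsHomogeneous e := by
  have h1 := Matrix.charpoly.univ_coeff_isHomogeneous ℂ n d e hde
  have h2 := h1.eval₂ (C : ℂ →+* MvPolynomial σ ℂ) (fun ac => genericMatrix b T ac.1 ac.2)
    (fun c => isHomogeneous_C _ c) (fun ac => isHomogeneous_genericMatrix b T ac.1 ac.2)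
  rw [one_mul] at h2
  convert h2 using 1
  have h3 := Matrix.charpoly.univ_map_eval₂Hom n (C : ℂ →+* MvPolynomial σ ℂ)
    (fun ac => genericMatrix b T ac.1 ac.2)
  have h4 := congrArg (fun p => Polynomial.coeff p d) h3
  rw [Polynomial.coeff_map] at h4
  exact h4.symm

/-- The characteristic polynomial is a power of `X`; Cayley-Hamilton concludes. -/
theorem Matrix.isNilpotent_of_charpoly_coeff_eq_zero {K : Type*} [Field K] {x : Matrix n n K}
    (h : ∀ d < Fintype.card n, x.charpoly.coeff d = 0) : IsNilpotent x := by
  refine ⟨Fintype.card n, ?_⟩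
  have h1 : x.charpoly = Polynomial.X ^ Fintype.card n := by
    ext d
    rw [Polynomial.coeff_X_pow]
    split_ifs with hd
    · have := x.charpoly_monic.coeff_natDegree
      rwa [Matrix.charpoly_natDegree_eq_dim, ← hd] at this
    · rcases lt_or_gt_of_ne hd with hd | hd
      · exact h d hd
      · exact Polynomial.coeff_eq_zero_of_natDegree_lt
          (by rwa [Matrix.charpoly_natDegree_eq_dim])
  have h2 := x.aeval_self_charpoly
  rwa [h1, map_pow, Polynomial.aeval_X] at h2

end GenericMatrices

theorem mem_span_range_linForm {X : Type*} [AddCommGroup X] [Module ℂ X] [FiniteDimensional ℂ X]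
    {σ ι : Type*} [Fintype σ] (b : Module.Basis σ ℂ X) (ψ : ι → Module.Dual ℂ X)
    (h : ∀ x, (∀ i, ψ i x = 0) → x = 0) (s : σ) :
    MvPolynomial.X s ∈ Submodule.span ℂ (Set.range fun i => linForm b (ψ i)) := by
  have h1 := Submodule.mem_map_of_mem (f := linForm b)
    (p := Submodule.span ℂ (Set.range ψ)) (r := b.coord s)
    (by rw [span_range_eq_top_of_forall_eq_zero ψ h]; trivial)
  rw [Submodule.map_span, ← Set.range_comp, linForm_coord] at h1
  exact h1

/-- A morphism from a vector space of matrix data to `Y × Sⁿℂ`, given by a part of the entries of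
the moment map and by the eigenvalues of the first matrix, is flat if the Liouville form vanishes
on the zero fibre of a suitable linear section. -/
theorem isFlatMorphism_of_liouville_eq_zero {X Y : Type u} [AddCommGroup X] [Module ℂ X]
    [FiniteDimensional ℂ X] [AddCommGroup Y] [Module ℂ Y] [FiniteDimensional ℂ Y]
    {n N : ℕ} {r ι τ κ : Type} [Fintype r] [Fintype ι] [Fintype τ] [Fintype κ]
    (b : Module.Basis (Fin N) ℂ X)
    (Tx Ty : X →ₗ[ℂ] Matrix (Fin n) (Fin n) ℂ) (Ti : X →ₗ[ℂ] Matrix (Fin n) r ℂ)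
    (Tj : X →ₗ[ℂ] Matrix r (Fin n) ℂ) (ent : ι → Fin n × Fin n)
    (ψ : ι → Module.Dual ℂ Y) (hψ : ∀ y, (∀ i, ψ i y = 0) → y = 0)
    (φ : X → Y × Sym ℂ n)
    (hφ₁ : ∀ x i, ψ i (φ x).1 =
      (Tx x * Ty x - Ty x * Tx x + Ti x * Tj x) (ent i).1 (ent i).2)
    (hφ₂ : ∀ x d, rootCoeff d (φ x).2 = (Tx x).charpoly.coeff d)
    (p q : κ → Module.Dual ℂ X) (l : τ → Module.Dual ℂ X)
    (hker : ∀ x, (∀ a, p a x = 0) → (∀ a, q a x = 0) → (∀ i, l i x = 0) → x = 0)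
    (hcard : Fintype.card ι + n + Fintype.card τ + Fintype.card κ ≤ N)
    (hpt : ∀ (K : Type) [Field K] [Algebra ℂ K] (z : Fin N → K),
      IsNilpotent ((genericMatrix b Tx).map (aeval z)) →
      (∀ i, (genericMoment b Tx Ty Ti Tj).map (aeval z) (ent i).1 (ent i).2 = 0) →
      (∀ i, aeval z (linForm b (l i)) = 0) → ∀ D : Derivation ℂ K K,
      ∑ a, aeval z (linForm b (p a)) * D (aeval z (linForm b (q a))) = 0) :
    IsFlatMorphism (polyFun X) (prodFun (polyFun Y) (symFun n)) φ := by
  let F : ι ⊕ Fin n → MvPolynomial (Fin N) ℂ :=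
    Sum.elim (fun i => genericMoment b Tx Ty Ti Tj (ent i).1 (ent i).2)
      fun d => (genericMatrix b Tx).charpoly.coeff d
  obtain ⟨h1, h2⟩ := flat_and_injective_of_liouville_eq_zero F
    (Sum.elim (fun _ => 2) fun d => n - d)
    (by
      rintro (i | d)
      · exact two_pos
      · exact Nat.sub_pos_of_lt d.2)
    (by
      rintro (i | d)
      · exact isHomogeneous_genericMoment b Tx Ty Ti Tj _ _
      · refine isHomogeneous_charpoly_coeff b Tx ?_
        rw [Fintype.card_fin]
        exact Nat.add_sub_cancel' d.2.le)
    (fun i => linForm b (l i)) (fun i => isHomogeneous_linForm b _)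
    (fun a => linForm b (p a)) (fun a => linForm b (q a))
    (fun s => by
      have := mem_span_range_linForm b (Sum.elim (Sum.elim p q) l)
        (fun x hx => hker x (fun a => hx (.inl (.inl a))) (fun a => hx (.inl (.inr a)))
          fun i => hx (.inr i)) s
      refine Submodule.span_mono ?_ this
      rintro _ ⟨(a | a) | a, rfl⟩
      · exact .inl (.inl ⟨a, rfl⟩)
      · exact .inl (.inr ⟨a, rfl⟩)
      · exact .inr ⟨a, rfl⟩)
    (by simpa using hcard)
    (fun K _ _ z hF hl D => hpt K z
      (by
        refine Matrix.isNilpotent_of_charpoly_coeff_eq_zero fun d hd => ?_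
        rw [Fintype.card_fin] at hd
        have h3 := Matrix.charpoly_map (genericMatrix b Tx) (aeval z : _ →ₐ[ℂ] K).toRingHom
        have h4 := congrArg (fun p => Polynomial.coeff p d) h3
        rw [Polynomial.coeff_map] at h4
        exact h4.trans (hF (.inr ⟨d, hd⟩)))
      (fun i => hF (.inl i)) hl D)
  refine isFlatMorphism_of_flat_aeval b _ φ _
    (prodFun_eq_adjoin n ψ (span_range_eq_top_of_forall_eq_zero ψ hψ)) F ?_ h1 h2
  rintro (i | d) <;> funext x
  · exact (evalFun_genericMoment b Tx Ty Ti Tj _ _ x).trans (hφ₁ x i).symm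
  · exact (evalFun_charpoly_coeff b Tx d x).trans (hφ₂ x d).symm

end

/-! ### The case of `M_{V,W}` -/

theorem isFlatMorphism_adhmMap (V W : Type u)
    [AddCommGroup V] [Module ℂ V] [FiniteDimensional ℂ V]
    [AddCommGroup W] [Module ℂ W] [FiniteDimensional ℂ W] (hW : 1 ≤ Module.finrank ℂ W) :
    IsFlatMorphism (polyFun (ADHMSpace V W))
      (prodFun (polyFun (Module.End ℂ V)) (symFun (Module.finrank ℂ V))) adhmMap := by
  obtain ⟨r, hr⟩ : ∃ r, Module.finrank ℂ W = r + 1 := ⟨Module.finrank ℂ W - 1, by omega⟩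
  let bV := Module.finBasis ℂ V
  let bW := Module.finBasisOfFinrankEq ℂ W hr
  let E (a c : Fin (Module.finrank ℂ V)) : Module.Dual ℂ (Module.End ℂ V) :=
    Matrix.entryLinearMap ℂ ℂ a c ∘ₗ (LinearMap.toMatrix bV bV).toLinearMap
  let Tx : ADHMSpace V W →ₗ[ℂ] _ := (LinearMap.toMatrix bV bV).toLinearMap ∘ₗ LinearMap.fst ℂ _ _
  let Ty : ADHMSpace V W →ₗ[ℂ] _ :=
    (LinearMap.toMatrix bV bV).toLinearMap ∘ₗ LinearMap.fst ℂ _ _ ∘ₗ LinearMap.snd ℂ _ _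
  let Ti : ADHMSpace V W →ₗ[ℂ] _ := (LinearMap.toMatrix bW bV).toLinearMap ∘ₗ
    LinearMap.fst ℂ _ _ ∘ₗ LinearMap.snd ℂ _ _ ∘ₗ LinearMap.snd ℂ _ _
  let Tj : ADHMSpace V W →ₗ[ℂ] _ := (LinearMap.toMatrix bV bW).toLinearMap ∘ₗ
    LinearMap.snd ℂ _ _ ∘ₗ LinearMap.snd ℂ _ _ ∘ₗ LinearMap.snd ℂ _ _
  -- The section keeps only the basis vector `0` of `W`, so that `i j` has rank one and a single
  -- vector has to be made horizontal. The entries of `B₂` are transposed in `p` so that `∑ p dq` is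
  -- `tr (B₂ dB₁) + j di`. With `k = dim V` and `dim W = r + 1`, the count is `k² + k + 2kr + (k² +
  -- k) = 2k² + 2k(r + 1)`.
  refine isFlatMorphism_of_liouville_eq_zero (Module.finBasis ℂ (ADHMSpace V W)) Tx Ty Ti Tj
    (ι := Fin (Module.finrank ℂ V) × Fin (Module.finrank ℂ V))
    (τ := (Fin (Module.finrank ℂ V) × Fin r) ⊕ (Fin r × Fin (Module.finrank ℂ V)))
    (κ := (Fin (Module.finrank ℂ V) × Fin (Module.finrank ℂ V)) ⊕ Fin (Module.finrank ℂ V))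
    id (fun ac => E ac.1 ac.2) ?_ adhmMap ?_ ?_
    (Sum.elim (fun ac => Matrix.entryLinearMap ℂ ℂ ac.2 ac.1 ∘ₗ Ty)
      fun a => Matrix.entryLinearMap ℂ ℂ 0 a ∘ₗ Tj)
    (Sum.elim (fun ac => Matrix.entryLinearMap ℂ ℂ ac.1 ac.2 ∘ₗ Tx)
      fun a => Matrix.entryLinearMap ℂ ℂ a 0 ∘ₗ Ti)
    (Sum.elim (fun as => Matrix.entryLinearMap ℂ ℂ as.1 as.2.succ ∘ₗ Ti)
      fun sa => Matrix.entryLinearMap ℂ ℂ sa.1.succ sa.2 ∘ₗ Tj) ?_ ?_ ?_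
  · intro A hA
    exact (LinearMap.toMatrix bV bV).map_eq_zero_iff.mp (Matrix.ext fun a c => hA (a, c))
  · rintro ⟨x, y, i, j⟩ ⟨a, c⟩
    change LinearMap.toMatrix bV bV (x * y - y * x + i ∘ₗ j) a c =
      (LinearMap.toMatrix bV bV x * LinearMap.toMatrix bV bV y -
        LinearMap.toMatrix bV bV y * LinearMap.toMatrix bV bV x +
        LinearMap.toMatrix bW bV i * LinearMap.toMatrix bV bW j) a c
    rw [map_add, map_sub, LinearMap.toMatrix_mul, LinearMap.toMatrix_mul,
      LinearMap.toMatrix_comp bV bW bV]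
  · rintro ⟨x, y, i, j⟩ d
    change rootCoeff d (eigenvalueMap x) = (LinearMap.toMatrix bV bV x).charpoly.coeff d
    rw [rootCoeff_eigenvalueMap, LinearMap.charpoly_toMatrix]
  · rintro ⟨x, y, i, j⟩ hp hq hl
    have hx : x = 0 := (LinearMap.toMatrix bV bV).map_eq_zero_iff.mp
      (Matrix.ext fun a c => hq (.inl (a, c)))
    have hy : y = 0 := (LinearMap.toMatrix bV bV).map_eq_zero_iff.mp
      (Matrix.ext fun a c => hp (.inl (c, a)))
    have hi : i = 0 := (LinearMap.toMatrix bW bV).map_eq_zero_iff.mp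
      (Matrix.ext fun a s => Fin.cases (hq (.inr a)) (fun s => hl (.inl (a, s))) s)
    have hj : j = 0 := (LinearMap.toMatrix bV bW).map_eq_zero_iff.mp
      (Matrix.ext fun s a => Fin.cases (hp (.inr a)) (fun s => hl (.inr (s, a))) s)
    rw [hx, hy, hi, hj]
    rfl
  · simp only [Fintype.card_prod, Fintype.card_sum, Fintype.card_fin, Module.finrank_prod,
      Module.finrank_linearMap, hr]
    apply le_of_eq
    ring
  · intro K _ _ z hx hF hl D
    have hM : (genericMoment _ Tx Ty Ti Tj).map (MvPolynomial.aeval z : _ →ₐ[ℂ] K) = 0 :=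
      Matrix.ext fun a c => hF (a, c)
    have hM' := (genericMoment_map _ (MvPolynomial.aeval z : _ →ₐ[ℂ] K).toRingHom
      Tx Ty Ti Tj).symm.trans hM
    rw [Fintype.sum_sum_type, Fintype.sum_prod_type]
    refine liouville_eq_zero_of_moment_eq_zero D hx
      (fun a => MvPolynomial.aeval z (genericMatrix _ Ti a 0))
      (fun a => MvPolynomial.aeval z (genericMatrix _ Tj 0 a)) ?_
    rw [← hM']
    congr 1
    ext a c
    -- On the section the columns `s.succ` of `i` vanish, so only the index `0` contributes to `i
    -- j`.
    rw [Matrix.mul_apply, Fin.sum_univ_succ, Finset.sum_eq_zero, add_zero]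
    · rfl
    · intro s _
      have : MvPolynomial.aeval z (genericMatrix (Module.finBasis ℂ (ADHMSpace V W)) Ti a s.succ)
          = 0 := hl (.inl (a, s))
      exact mul_eq_zero_of_left this _

/-! ### The orthogonal-symplectic case `N_{V,W}` -/

section OrthonormalBasis

variable {V : Type*} [AddCommGroup V] [Module ℂ V] {β : LinearMap.BilinForm ℂ V}

/-- An orthogonal basis is rescaled by inverse square roots, available over `ℂ`. In such a basis the
adjoint is the transpose. -/
theorem exists_basis_of_isSymm_of_nondegenerate [FiniteDimensional ℂ V] (hs : β.IsSymm)
    (hn : β.Nondegenerate) : ∃ v : Module.Basis (Fin (Module.finrank ℂ V)) ℂ V,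
      ∀ a c, β (v a) (v c) = if a = c then 1 else 0 := by
  have : Invertible (2 : ℂ) := invertibleOfNonzero two_ne_zero
  obtain ⟨u, hu⟩ := LinearMap.BilinForm.exists_orthogonal_basis ⟨hs.eq⟩
  have h0 (a) : β (u a) (u a) ≠ 0 := hu.not_isOrtho_basis_self_of_separatingLeft hn.1 a
  choose w hw using fun a => IsAlgClosed.exists_eq_mul_self (β (u a) (u a))
  have hw0 (a) : w a ≠ 0 := fun h => h0 a (by rw [hw, h, mul_zero])
  refine ⟨u.isUnitSMul fun a => (inv_ne_zero (hw0 a)).isUnit, fun a c => ?_⟩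
  rw [Module.Basis.isUnitSMul_apply, Module.Basis.isUnitSMul_apply, map_smul,
    map_smul, LinearMap.smul_apply, smul_eq_mul, smul_eq_mul]
  split_ifs with h
  · subst h
    rw [hw]
    field_simp [hw0 a]
  · rw [show β (u a) (u c) = 0 from hu h, mul_zero, mul_zero]

variable {ι : Type*} [Fintype ι] [DecidableEq ι] {v : Module.Basis ι ℂ V}

theorem toMatrix_eq_apply_of_orthonormal (hv : ∀ a c, β (v a) (v c) = if a = c then 1 else 0)
    (A : Module.End ℂ V) (a c : ι) : LinearMap.toMatrix v v A a c = β (v a) (A (v c)) := by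
  rw [LinearMap.toMatrix_apply]
  conv_rhs => rw [← v.sum_repr (A (v c)), map_sum]
  simp [hv, -Module.Basis.sum_repr]

theorem mem_selfAdjointSubmodule_iff_toMatrix (hs : β.IsSymm)
    (hv : ∀ a c, β (v a) (v c) = if a = c then 1 else 0) (A : Module.End ℂ V) :
    A ∈ β.selfAdjointSubmodule ↔
      ∀ a c, LinearMap.toMatrix v v A a c = LinearMap.toMatrix v v A c a := by
  rw [LinearMap.mem_selfAdjointSubmodule]
  simp only [toMatrix_eq_apply_of_orthonormal hv]
  refine ⟨fun h a c => ?_, fun h => ?_⟩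
  · rw [hs.eq (v c)]
    exact (h (v a) (v c)).symm
  · refine LinearMap.isAdjointPair_iff_comp_eq_compl₂.mpr (LinearMap.ext_basis v v fun a c => ?_)
    change β (A (v a)) (v c) = β (v a) (A (v c))
    rw [h, hs.eq _ (v c)]

theorem toMatrix_of_mem_skewAdjointSubmodule (hs : β.IsSymm)
    (hv : ∀ a c, β (v a) (v c) = if a = c then 1 else 0) {A : Module.End ℂ V}
    (hA : A ∈ β.skewAdjointSubmodule) (a c : ι) :
    LinearMap.toMatrix v v A a c = -LinearMap.toMatrix v v A c a := by
  rw [LinearMap.mem_skewAdjointSubmodule] at hA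
  have h : β (A (v a)) (v c) = β (v a) ((-A) (v c)) := hA (v a) (v c)
  rw [toMatrix_eq_apply_of_orthonormal hv, toMatrix_eq_apply_of_orthonormal hv, hs.eq (v c), h]
  simp

end OrthonormalBasis

/-- Adjoints exist for a nondegenerate alternating form. -/
theorem exists_isAdjointPair_of_isAlt {V W : Type*} [AddCommGroup V] [Module ℂ V]
    [AddCommGroup W] [Module ℂ W] [FiniteDimensional ℂ W] {βV : LinearMap.BilinForm ℂ V}
    {βW : LinearMap.BilinForm ℂ W} (hW : βW.IsAlt) (hn : βW.Nondegenerate) (i : W →ₗ[ℂ] V) :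
    ∃ j : V →ₗ[ℂ] W, LinearMap.IsAdjointPair βW βV i j := by
  refine ⟨-((βW.toDual hn).symm.toLinearMap ∘ₗ βV.flip.compl₂ i), fun w v => ?_⟩
  have h : βW ((βW.toDual hn).symm (βV.flip.compl₂ i v)) w = βV.flip.compl₂ i v w := by
    rw [← LinearMap.BilinForm.toDual_def hn, LinearEquiv.apply_symm_apply]
  rw [LinearMap.neg_apply, map_neg, LinearMap.IsAlt.neg hW]
  exact h.symm

/-- The coordinates on symmetric matrices are the entries with `a ≤ c`, so in the trace form each
off-diagonal entry counts twice. The added `if` term is that second copy. -/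
theorem Fintype.sum_symm_eq_sum_le {K : Type*} [CommRing K] {n : ℕ} (f : Fin n → Fin n → K)
    (hf : ∀ a c, f a c = f c a) :
    ∑ s : {ac : Fin n × Fin n // ac.1 ≤ ac.2},
      (f s.1.1 s.1.2 + if s.1.1 = s.1.2 then 0 else f s.1.1 s.1.2) = ∑ a, ∑ c, f a c := by
  have h1 (ac : Fin n × Fin n) : f ac.1 ac.2 =
      (if ac.1 ≤ ac.2 then f ac.1 ac.2 else 0) + if ac.2 < ac.1 then f ac.1 ac.2 else 0 := by
    rcases le_or_gt ac.1 ac.2 with h | h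
    · simp [h, not_lt.mpr h]
    · simp [h, not_le.mpr h]
  have h2 : ∑ ac : Fin n × Fin n, (if ac.2 < ac.1 then f ac.1 ac.2 else 0) =
      ∑ ac : Fin n × Fin n, if ac.1 < ac.2 then f ac.1 ac.2 else 0 :=
    Fintype.sum_equiv (Equiv.prodComm _ _) _ _ fun ac => by
      simp only [Equiv.prodComm_apply, Prod.fst_swap, Prod.snd_swap, hf ac.2 ac.1]
  have h3 : ∑ ac : Fin n × Fin n, f ac.1 ac.2 =
      ∑ ac : Fin n × Fin n, if ac.1 ≤ ac.2 then
        f ac.1 ac.2 + (if ac.1 = ac.2 then 0 else f ac.1 ac.2) else 0 := by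
    rw [Fintype.sum_congr _ _ h1, Finset.sum_add_distrib, h2, ← Finset.sum_add_distrib]
    refine Fintype.sum_congr _ _ fun ac => ?_
    rcases lt_trichotomy ac.1 ac.2 with h | h | h
    · simp [h, h.le, h.ne]
    · simp [h]
    · simp [not_le.mpr h, not_lt.mpr h.le]
  rw [← Fintype.sum_prod_type', h3, ← Finset.sum_filter]
  exact (Finset.sum_subtype _ (by simp) fun ac : Fin n × Fin n =>
    f ac.1 ac.2 + if ac.1 = ac.2 then 0 else f ac.1 ac.2).symm

/-- With `k = dim V`, the space maps onto two symmetric matrices and an arbitrary `i`, hence has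
dimension at least `k(k+1) + k dim W`. The left side has the same value: the `k` eigenvalue
equations make up for the diagonal missing among the `k(k-1)/2` moment equations. -/
theorem card_le_finrank_selfAdjointSpace {V W : Type u} [AddCommGroup V] [Module ℂ V]
    [FiniteDimensional ℂ V] [AddCommGroup W] [Module ℂ W] [FiniteDimensional ℂ W]
    {βV : LinearMap.BilinForm ℂ V} {βW : LinearMap.BilinForm ℂ W}
    (hV : βV.IsSymm) (hW : βW.IsAlt) (hnW : βW.Nondegenerate) {n : ℕ}
    {v : Module.Basis (Fin n) ℂ V} (hv : ∀ a c, βV (v a) (v c) = if a = c then 1 else 0) :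
    Fintype.card {ac : Fin n × Fin n // ac.1 < ac.2} + n +
      Fintype.card (Fin n × Fin (Module.finrank ℂ W)) +
      Fintype.card {ac : Fin n × Fin n // ac.1 ≤ ac.2} ≤
      Module.finrank ℂ (selfAdjointSpace βV βW) := by
  have h1 : Fintype.card {ac : Fin n × Fin n // ac.1 < ac.2} + n ≤
      Fintype.card {ac : Fin n × Fin n // ac.1 ≤ ac.2} := by
    have := Fintype.card_le_of_injective (α := {ac : Fin n × Fin n // ac.1 < ac.2} ⊕ Fin n)
      (β := {ac : Fin n × Fin n // ac.1 ≤ ac.2})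
      (Sum.elim (fun s => ⟨s.1, s.2.le⟩) fun a => ⟨(a, a), le_rfl⟩) (by
        rintro (⟨⟨a, c⟩, h⟩ | a) (⟨⟨a', c'⟩, h'⟩ | a') he <;>
          simp only [Sum.elim_inl, Sum.elim_inr, Subtype.mk.injEq, Prod.mk.injEq] at he
        · simp [he.1, he.2]
        · exact absurd (he.1.trans he.2.symm) h.ne
        · exact absurd (he.1.symm.trans he.2) h'.ne
        · simp [he.1])
    simpa using this
  let T : (Module.End ℂ V) →ₗ[ℂ] {ac : Fin n × Fin n // ac.1 ≤ ac.2} → ℂ :=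
    LinearMap.pi fun s => Matrix.entryLinearMap ℂ ℂ s.1.1 s.1.2 ∘ₗ
      (LinearMap.toMatrix v v).toLinearMap
  have hT (s) : ∃ A ∈ βV.selfAdjointSubmodule, T A = s := by
    refine ⟨(LinearMap.toMatrix v v).symm (Matrix.of fun a c =>
      s ⟨(min a c, max a c), min_le_max⟩), ?_, funext fun ac => ?_⟩
    · rw [mem_selfAdjointSubmodule_iff_toMatrix hV hv, LinearEquiv.apply_symm_apply]
      intro a c
      simp only [Matrix.of_apply, min_comm, max_comm]
    · change LinearMap.toMatrix v v _ ac.1.1 ac.1.2 = s ac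
      rw [LinearEquiv.apply_symm_apply, Matrix.of_apply]
      congr 1
      exact Subtype.ext (Prod.ext (min_eq_left ac.2) (max_eq_right ac.2))
  let F : selfAdjointSpace βV βW →ₗ[ℂ] ({ac : Fin n × Fin n // ac.1 ≤ ac.2} → ℂ) ×
      ({ac : Fin n × Fin n // ac.1 ≤ ac.2} → ℂ) × (W →ₗ[ℂ] V) :=
    (T.prodMap (T.prodMap (LinearMap.fst ℂ (W →ₗ[ℂ] V) (V →ₗ[ℂ] W)))) ∘ₗ
      (selfAdjointSpace βV βW).subtype
  have hF : Function.Surjective F := by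
    rintro ⟨s, t, i⟩
    obtain ⟨x, hx, rfl⟩ := hT s
    obtain ⟨y, hy, rfl⟩ := hT t
    obtain ⟨j, hj⟩ := exists_isAdjointPair_of_isAlt (βV := βV) hW hnW i
    exact ⟨⟨(x, y, i, j), hx, hy, hj⟩, rfl⟩
  have h2 := F.finrank_le_finrank_of_surjective hF
  rw [Module.finrank_prod, Module.finrank_prod, Module.finrank_linearMap,
    Module.finrank_fintype_fun_eq_card, Module.finrank_eq_card_basis v, Fintype.card_fin, mul_comm] at h2
  rw [Fintype.card_prod, Fintype.card_fin, Fintype.card_fin]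
  omega

/-- The section sets all of `i` to zero, which works equally for `W = 0`. What remains is a
commutator of symmetric matrices; it is skew, so its vanishing above the diagonal is enough, and the
Liouville lemma applies with zero vectors. -/
theorem isFlatMorphism_spMap {V W : Type u} [AddCommGroup V] [Module ℂ V]
    [FiniteDimensional ℂ V] [AddCommGroup W] [Module ℂ W] [FiniteDimensional ℂ W]
    {βV : LinearMap.BilinForm ℂ V} {βW : LinearMap.BilinForm ℂ W}
    (hV : βV.IsSymm) (hW : βW.IsAlt) (hnV : βV.Nondegenerate) (hnW : βW.Nondegenerate) :
    IsFlatMorphism (polyFun (selfAdjointSpace βV βW))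
      (prodFun (polyFun βV.skewAdjointSubmodule) (symFun (Module.finrank ℂ V)))
      (spMap hV hW) := by
  obtain ⟨v, hv⟩ := exists_basis_of_isSymm_of_nondegenerate hV hnV
  let bW := Module.finBasis ℂ W
  let Tx : selfAdjointSpace βV βW →ₗ[ℂ] _ := (LinearMap.toMatrix v v).toLinearMap ∘ₗ
    LinearMap.fst ℂ _ _ ∘ₗ (selfAdjointSpace βV βW).subtype
  let Ty : selfAdjointSpace βV βW →ₗ[ℂ] _ := (LinearMap.toMatrix v v).toLinearMap ∘ₗ
    LinearMap.fst ℂ _ _ ∘ₗ LinearMap.snd ℂ _ _ ∘ₗ (selfAdjointSpace βV βW).subtype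
  let Ti : selfAdjointSpace βV βW →ₗ[ℂ] _ := (LinearMap.toMatrix bW v).toLinearMap ∘ₗ
    LinearMap.fst ℂ _ _ ∘ₗ LinearMap.snd ℂ _ _ ∘ₗ LinearMap.snd ℂ _ _ ∘ₗ
      (selfAdjointSpace βV βW).subtype
  let Tj : selfAdjointSpace βV βW →ₗ[ℂ] _ := (LinearMap.toMatrix v bW).toLinearMap ∘ₗ
    LinearMap.snd ℂ _ _ ∘ₗ LinearMap.snd ℂ _ _ ∘ₗ LinearMap.snd ℂ _ _ ∘ₗ
      (selfAdjointSpace βV βW).subtype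
  have hTx (x : selfAdjointSpace βV βW) (a c) : Tx x a c = Tx x c a :=
    (mem_selfAdjointSubmodule_iff_toMatrix hV hv _).mp x.2.1 a c
  have hTy (x : selfAdjointSpace βV βW) (a c) : Ty x a c = Ty x c a :=
    (mem_selfAdjointSubmodule_iff_toMatrix hV hv _).mp x.2.2.1 a c
  let b := Module.finBasis ℂ (selfAdjointSpace βV βW)
  have hgx (a c) : genericMatrix b Tx a c = genericMatrix b Tx c a :=
    congrArg (linForm b) (LinearMap.ext fun x => hTx x a c)
  have hgy (a c) : genericMatrix b Ty a c = genericMatrix b Ty c a :=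
    congrArg (linForm b) (LinearMap.ext fun x => hTy x a c)
  refine isFlatMorphism_of_liouville_eq_zero b Tx Ty Ti Tj
    (ι := {ac : Fin (Module.finrank ℂ V) × Fin (Module.finrank ℂ V) // ac.1 < ac.2})
    (τ := Fin (Module.finrank ℂ V) × Fin (Module.finrank ℂ W))
    (κ := {ac : Fin (Module.finrank ℂ V) × Fin (Module.finrank ℂ V) // ac.1 ≤ ac.2})
    Subtype.val (fun s => Matrix.entryLinearMap ℂ ℂ s.1.1 s.1.2 ∘ₗ
      (LinearMap.toMatrix v v).toLinearMap ∘ₗ Submodule.subtype _) ?_ (spMap hV hW) ?_ ?_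
    (fun s => Matrix.entryLinearMap ℂ ℂ s.1.1 s.1.2 ∘ₗ Ty +
      if s.1.1 = s.1.2 then 0 else Matrix.entryLinearMap ℂ ℂ s.1.1 s.1.2 ∘ₗ Ty)
    (fun s => Matrix.entryLinearMap ℂ ℂ s.1.1 s.1.2 ∘ₗ Tx)
    (fun as => Matrix.entryLinearMap ℂ ℂ as.1 as.2 ∘ₗ Ti) ?_ ?_ ?_
  · rintro ⟨A, hA⟩ h
    have hs := toMatrix_of_mem_skewAdjointSubmodule hV hv hA
    have h' (a c) (hac : a < c) : LinearMap.toMatrix v v A a c = 0 := h ⟨(a, c), hac⟩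
    refine Subtype.ext ((LinearMap.toMatrix v v).map_eq_zero_iff.mp (Matrix.ext fun a c => ?_))
    rcases lt_trichotomy a c with hac | rfl | hac
    · exact h' a c hac
    · exact self_eq_neg.mp (hs a a)
    · rw [hs, h' c a hac, neg_zero]
      rfl
  · rintro ⟨⟨x, y, i, j⟩, hx⟩ ⟨⟨a, c⟩, hac⟩
    change LinearMap.toMatrix v v (x * y - y * x + i ∘ₗ j) a c =
      (LinearMap.toMatrix v v x * LinearMap.toMatrix v v y -
        LinearMap.toMatrix v v y * LinearMap.toMatrix v v x +
        LinearMap.toMatrix bW v i * LinearMap.toMatrix v bW j) a c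
    rw [map_add, map_sub, LinearMap.toMatrix_mul, LinearMap.toMatrix_mul,
      LinearMap.toMatrix_comp v bW v]
  · rintro ⟨⟨x, y, i, j⟩, hx⟩ d
    change rootCoeff d (eigenvalueMap x) = (LinearMap.toMatrix v v x).charpoly.coeff d
    rw [rootCoeff_eigenvalueMap, LinearMap.charpoly_toMatrix]
  · intro x hp hq hl
    have hy0 (a c) (hac : a ≤ c) : Ty x a c = 0 := by
      have h := hp ⟨(a, c), hac⟩
      dsimp only at h
      split_ifs at h with he
      · rwa [add_zero] at h
      · exact self_eq_neg.mp (eq_neg_of_add_eq_zero_left h)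
    have hx : x.1.1 = 0 := (LinearMap.toMatrix v v).map_eq_zero_iff.mp
      (Matrix.ext fun a c => (le_total a c).elim (fun h => hq ⟨(a, c), h⟩)
        fun h => (hTx x a c).trans (hq ⟨(c, a), h⟩))
    have hy : x.1.2.1 = 0 := (LinearMap.toMatrix v v).map_eq_zero_iff.mp
      (Matrix.ext fun a c => (le_total a c).elim (fun h => hy0 a c h)
        fun h => (hTy x a c).trans (hy0 c a h))
    have hi : x.1.2.2.1 = 0 := (LinearMap.toMatrix bW v).map_eq_zero_iff.mp
      (Matrix.ext fun a s => hl (a, s))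
    -- No coordinate of `j` is needed: by adjointness and nondegeneracy of `βW`, `i = 0` forces `j =
    -- 0`.
    have hj : x.1.2.2.2 = 0 := LinearMap.ext fun u => hnW.2 _ fun w => by
      rw [← show βV (x.1.2.2.1 w) u = βW w (x.1.2.2.2 u) from x.2.2.2 w u, hi]
      simp
    exact Subtype.ext (Prod.ext hx (Prod.ext hy (Prod.ext hi hj)))
  · exact card_le_finrank_selfAdjointSpace hV hW hnW hv
  · intro K _ _ z hx hF hl D
    have hK : CharZero K := charZero_of_injective_algebraMap (algebraMap ℂ K).injective
    set e : MvPolynomial (Fin (Module.finrank ℂ (selfAdjointSpace βV βW))) ℂ →ₐ[ℂ] K :=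
      MvPolynomial.aeval z
    set x := (genericMatrix b Tx).map e
    set y := (genericMatrix b Ty).map e
    have hxs : x.transpose = x := Matrix.ext fun a c => congrArg e (hgx c a)
    have hys : y.transpose = y := Matrix.ext fun a c => congrArg e (hgy c a)
    have hI : (genericMatrix b Ti).map e = 0 := Matrix.ext fun a s => hl (a, s)
    have hM : (genericMoment b Tx Ty Ti Tj).map e = x * y - y * x := by
      refine (genericMoment_map b e.toRingHom Tx Ty Ti Tj).trans ?_
      change x * y - y * x + (genericMatrix b Ti).map e * _ = _
      rw [hI, Matrix.zero_mul, add_zero]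
    have hskew (a c) : (x * y - y * x) a c = -(x * y - y * x) c a := by
      have h : (x * y - y * x).transpose = -(x * y - y * x) := by
        rw [Matrix.transpose_sub, Matrix.transpose_mul, Matrix.transpose_mul, hxs, hys, neg_sub]
      exact congrFun (congrFun h c) a
    have h0 (a c) (hac : a < c) : (x * y - y * x) a c = 0 := by
      rw [← hM]
      exact hF ⟨(a, c), hac⟩
    have hcomm : x * y - y * x = 0 := by
      ext a c
      rcases lt_trichotomy a c with hac | rfl | hac
      · exact h0 a c hac
      · exact self_eq_neg.mp (hskew a a)
      · rw [hskew, h0 c a hac, neg_zero]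
        rfl
    have h1 := liouville_eq_zero_of_moment_eq_zero D hx 0 0 (y := y)
      (by rw [Matrix.vecMulVec_zero, add_zero, hcomm])
    simp only [Pi.zero_apply, zero_mul, Finset.sum_const_zero, add_zero] at h1
    rw [← Fintype.sum_symm_eq_sum_le (fun a c => y c a * D (x a c)) fun a c => by
      rw [← congrFun (congrFun hxs a) c, ← congrFun (congrFun hys a) c]
      rfl] at h1
    rw [← h1]
    refine Fintype.sum_congr _ _ fun s => ?_
    have hs : e (linForm b (Matrix.entryLinearMap ℂ ℂ s.1.1 s.1.2 ∘ₗ Ty)) = y s.1.2 s.1.1 :=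
      congrArg e (hgy s.1.1 s.1.2)
    have hs' : e (linForm b (Matrix.entryLinearMap ℂ ℂ s.1.1 s.1.2 ∘ₗ Tx)) = x s.1.1 s.1.2 := rfl
    rw [map_add, map_add, hs, hs', add_mul]
    split_ifs
    · simp
    · rw [hs]

theorem lemma4p1 (V W : Type u)
    [AddCommGroup V] [Module ℂ V] [FiniteDimensional ℂ V]
    [AddCommGroup W] [Module ℂ W] [FiniteDimensional ℂ W] :
    (1 ≤ Module.finrank ℂ W →
      IsFlatMorphism (polyFun (ADHMSpace V W))
        (prodFun (polyFun (Module.End ℂ V)) (symFun (Module.finrank ℂ V)))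
        adhmMap) ∧
    (∀ (βV : LinearMap.BilinForm ℂ V) (βW : LinearMap.BilinForm ℂ W)
      (hV : βV.IsSymm) (hW : βW.IsAlt), βV.Nondegenerate → βW.Nondegenerate →
      IsFlatMorphism (polyFun (selfAdjointSpace βV βW))
        (prodFun (polyFun βV.skewAdjointSubmodule) (symFun (Module.finrank ℂ V)))
        (spMap hV hW)) :=
  ⟨isFlatMorphism_adhmMap V W, fun _ _ hV hW => isFlatMorphism_spMap hV hW⟩
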